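/- Collective tree exploration (complete communication). A team of $k\ge 1$ robots starts at the root $r$ of an unknown finite unweighted rooted tree $T$. In each synchronous round every robot either stays where it is or moves along one incident edge. When a node is visited for the first time, all edges incident to it are discovered, and the whole team learns of them. A (deterministic, centralized) exploration algorithm for $k$ robots is a function that determines the moves of the robots in each round from the common knowledge of the team: the positions of all robots in the present and all past rounds, and the graph of the edges discovered so far (nodes carry arbitrary, adversarially chosen distinct names, and a dangling edge, i.e. a discovered edge with an unvisited endpoint, is identified by the name of that endpoint). The runtime of an algorithm on $T$ is the first time $t\geq 0$ such that within the first $t$ rounds every edge of $T$ has been traversed by some robot and after $t$ rounds all robots are at the root (it is $\infty$ if there is no such $t$). The depth of $T$ is the maximum distance of a node to the root. Theorem. There is a family $\mathcal{A}=(\mathcal{A}_k)_{k\ge 1}$, where $\mathcal{A}_k$ is an exploration algorithm for $k$ robots, with the following properties. 1. There is an absolute constant $C>0$ such that for every $k\ge 1$ and every finite rooted tree $T$ with $n$ nodes and depth $D$ (and every naming of its nodes), the runtime of $\mathcal{A}_k$ on $T$ is at most $$\frac{2n}{k}+C\,kD .$$ 2. For $k\ge 1$ let $\mathcal{A}'_k$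 be the algorithm for $k$ robots which uses $\mathcal{A}_{k'}$ with $k'=\lfloor\sqrt{k}\rfloor$ of the robots and leaves the other $k-k'$ robots idle at the root. Then $\mathcal{A}'$ has a competitive ratio of $O(\sqrt{k})$: there is an absolute constant $C'>0$ such that for every $k\ge 1$ and every finite rooted tree $T$ with $n$ nodes and depth $D$ (and every naming of its nodes), the runtime of $\mathcal{A}'_k$ on $T$ is at most $$C'\sqrt{k}\left(\frac{n}{k}+D\right).$$ -/

import Mathlib

universe u

namespace CTE

/-- What the whole team knows at the beginning of a round (complete communication).
The nodes of the unknown tree carry arbitrary names, which are natural numbers.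
* `history`: the positions of all robots at the present and at all past rounds, latest first;
* `map`: the graph of discovered edges, i.e. of the edges incident to a visited node.
The visited nodes are those that occur in `history`; a dangling edge is an edge of `map` with
an endpoint that does not occur there, and the name of that endpoint identifies it. -/
structure Knowledge (k : ℕ) where
  history : List (Fin k → ℕ)
  map : SimpleGraph ℕ

/-- A (deterministic, centralized) exploration algorithm for `k` robots. Given the knowledge of
the team it tells each robot either to stay (`none`) or to move to the neighbour with a given
name (`some a`). -/
def Algorithm (k : ℕ) : Type := Knowledge k → Fin k → Option ℕ

/-- The present and past positions of the robots (`past` has the latest round first). -/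
structure State (k : ℕ) (V : Type*) where
  pos : Fin k → V
  past : List (Fin k → V)

section Run

variable {k : ℕ} {V : Type*} (G : SimpleGraph V) (r : V) (name : V ↪ ℕ) (A : Algorithm k)

/-- The nodes that some robot has visited so far. -/
def State.visited (S : State k V) : Set V := {v | ∃ c ∈ S.pos :: S.past, ∃ i, c i = v}

/-- The edges discovered so far: all the edges incident to a visited node. -/
def State.discovered (S : State k V) : SimpleGraph V where
  Adj u v := G.Adj u v ∧ (u ∈ S.visited ∨ v ∈ S.visited)
  symm := ⟨fun _ _ h => ⟨h.1.symm, h.2.symm⟩⟩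
  loopless := ⟨fun _ h => h.1.ne rfl⟩

/-- The knowledge of the team: everything is expressed through the names of the nodes. -/
def State.knowledge (S : State k V) : Knowledge k where
  history := (S.pos :: S.past).map fun c i => name (c i)
  map := (S.discovered G).map name

open Classical in
/-- The node reached from `u` by an instruction; an instruction that names no neighbour of `u`
has no effect. -/
noncomputable def move (u : V) : Option ℕ → V
  | none => u
  | some a => if h : ∃ v, G.Adj u v ∧ name v = a then h.choose else u

/-- One synchronous round. -/
noncomputable def State.step (S : State k V) : State k V where
  pos i := move G name (S.pos i) (A (S.knowledge G name) i)
  past := S.pos :: S.past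

/-- The state after `t` rounds; all robots start at the root `r`. -/
noncomputable def run (t : ℕ) : State k V :=
  (fun S => S.step G name A)^[t] ⟨fun _ => r, []⟩

/-- Some robot has gone through the edge `uv`, in one direction or the other, within the first
`t` rounds. -/
def Traversed (t : ℕ) (u v : V) : Prop :=
  ∃ s < t, ∃ i,
    ((run G r name A s).pos i = u ∧ (run G r name A (s + 1)).pos i = v) ∨
    ((run G r name A s).pos i = v ∧ (run G r name A (s + 1)).pos i = u)

/-- After `t` rounds all edges have been traversed and all robots are at the root. -/
def Terminated (t : ℕ) : Prop :=
  (∀ u v, G.Adj u v → Traversed G r name A t u v) ∧ ∀ i, (run G r name A t).pos i = r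

/-- The number of rounds before termination; `⊤` if the exploration never terminates. -/
noncomputable def runtime : ℕ∞ := ⨅ (t : ℕ) (_ : Terminated G r name A t), (t : ℕ∞)

/-- The depth of a finite tree: the largest distance of a node to the root. -/
noncomputable def depth [Fintype V] : ℕ := Finset.univ.sup fun v => G.dist r v

end Run

/-- Keep only the positions of the first `k'` robots in the knowledge of `k` robots. -/
def Knowledge.restrict {k' k : ℕ} (h : k' ≤ k) (K : Knowledge k) : Knowledge k' where
  history := K.history.map fun c i => c (Fin.castLE h i)
  map := K.map

/-- The algorithm for `k` robots that uses the algorithm `A` with the first `k'` robots and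
leaves the other `k - k'` robots idle (at the root, where they start). -/
def Algorithm.withIdle {k' k : ℕ} (h : k' ≤ k) (A : Algorithm k') : Algorithm k := fun K i =>
  if hi : i.val < k' then A (K.restrict h) ⟨i.val, hi⟩ else none

end CTE

/-!
Each robot has an anchor and explores depth-first below it; different anchors are incomparable, and
all dangling edges are at anchors or between a robot and its anchor. When an anchor has run out of
dangling edges, its robots strictly below it are re-anchored one step below it, and each robot
whose anchor is not open any more is sent to the open anchor `v` of least cost. The cost is
measured by overlaps of paths from the root: three times the increase of the overlap with the other
anchors, plus the number of edges that the robot leaves to others.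

Amortize over twice the number of unvisited nodes plus the distances of the robots to their anchors.
A round lowers this quantity by at least `k`, except for the walks of re-anchored robots. To pay for
these walks, compare the anchors with `3k` tokens that may be placed freely at open anchors, but
with at most as many tokens as robots at any other node, and consider the least energy
`∑ₑ xₑ (xₑ - 1)` of such a placement, where `xₑ` is the number of tokens below the edge `e`.
Re-anchoring a robot from `u` to an open node gives the tokens less freedom, so this least energy
cannot decrease. It increases enough: since there are three times as many tokens as robots, in an
optimal placement some token at an open node sees at least `2/3` of the cost of that node more
overlap than it would see at `u`, and it could have been placed at `u` before. All energies are
`O(k² D)`, so after `t` rounds `k t ≤ 2 n + O(k² D)`. Once there is no dangling edge, all robots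
return within `D` rounds. With `√k` instead of `k` robots the two terms of the bound are balanced.
-/

namespace CTE

open Finset

/-- A rooted tree on the whole type `V`, given by its parent function and the depths of its nodes.
The parent of the root is the root itself, so that iterating `parent` always makes sense. -/
structure ParentTree (V : Type*) where
  root : V
  parent : V → V
  depth : V → ℕ
  parent_root : parent root = root
  depth_root : depth root = 0
  depth_of_ne_root : ∀ v, v ≠ root → depth v = depth (parent v) + 1

namespace ParentTree

variable {V : Type*}

@[elab_as_elim]
theorem parent_induction {T : ParentTree V} {p : V → Prop} (root : p T.root)
    (step : ∀ v, v ≠ T.root → p (T.parent v) → p v) (v : V) : p v := by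
  induction h : T.depth v generalizing v with
  | zero =>
    by_cases hv : v = T.root
    · exact hv ▸ root
    · have := T.depth_of_ne_root v hv; omega
  | succ n ih =>
    by_cases hv : v = T.root
    · exact hv ▸ root
    · exact step v hv (ih _ (by have := T.depth_of_ne_root v hv; omega))

theorem parent_ne_self {T : ParentTree V} {c : V} (hc : c ≠ T.root) : T.parent c ≠ c := fun h => by
  have := T.depth_of_ne_root c hc; rw [h] at this; omega

variable [DecidableEq V] (T : ParentTree V)

/-- The set of ancestors of `v`, including `v` itself and the root. A non-root node stands for the
edge to its parent, so this is also the path from the root to `v`. -/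
def anc (v : V) : Finset V := (range (T.depth v + 1)).image fun n => T.parent^[n] v

variable {T} {a c d u v w : V}

theorem anc_root : T.anc T.root = {T.root} := by
  simp [anc, T.depth_root]

theorem anc_eq_insert (hv : v ≠ T.root) : T.anc v = insert v (T.anc (T.parent v)) := by
  ext w
  simp only [anc, mem_image, mem_range, mem_insert, T.depth_of_ne_root v hv]
  constructor
  · rintro ⟨n, hn, rfl⟩
    cases n with
    | zero => exact Or.inl rfl
    | succ n => exact Or.inr ⟨n, by omega, rfl⟩
  · rintro (rfl | ⟨n, hn, rfl⟩)
    · exact ⟨0, by omega, rfl⟩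
    · exact ⟨n + 1, by omega, rfl⟩

theorem mem_anc_iff (hv : v ≠ T.root) : u ∈ T.anc v ↔ u = v ∨ u ∈ T.anc (T.parent v) := by
  rw [anc_eq_insert hv, mem_insert]

theorem mem_anc_root : u ∈ T.anc T.root ↔ u = T.root := by
  rw [anc_root, mem_singleton]

theorem self_mem_anc (v : V) : v ∈ T.anc v :=
  mem_image.2 ⟨0, by simp, rfl⟩

theorem root_mem_anc (v : V) : T.root ∈ T.anc v := by
  induction v using T.parent_induction with
  | root => exact self_mem_anc _
  | step v hv ih => exact (mem_anc_iff hv).2 (Or.inr ih)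

theorem anc_parent_subset (v : V) : T.anc (T.parent v) ⊆ T.anc v := by
  by_cases hv : v = T.root
  · rw [hv, T.parent_root]
  · rw [anc_eq_insert hv]; exact subset_insert _ _

theorem parent_mem_anc (v : V) : T.parent v ∈ T.anc v := anc_parent_subset v (self_mem_anc _)

theorem anc_subset (h : u ∈ T.anc v) : T.anc u ⊆ T.anc v := by
  induction v using T.parent_induction with
  | root => rw [mem_anc_root.1 h]
  | step v hv ih =>
    rcases (mem_anc_iff hv).1 h with rfl | h
    · exact Subset.rfl
    · exact (ih h).trans (anc_parent_subset v)

theorem depth_le_of_mem_anc (h : u ∈ T.anc v) : T.depth u ≤ T.depth v := by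
  induction v using T.parent_induction with
  | root => rw [mem_anc_root.1 h]
  | step v hv ih =>
    rcases (mem_anc_iff hv).1 h with rfl | h
    · exact le_rfl
    · have := ih h; have := T.depth_of_ne_root v hv; omega

theorem notMem_anc_parent (hv : v ≠ T.root) : v ∉ T.anc (T.parent v) := fun h => by
  have := depth_le_of_mem_anc h; have := T.depth_of_ne_root v hv; omega

theorem mem_anc_parent (h : u ∈ T.anc v) (hne : u ≠ v) : u ∈ T.anc (T.parent v) := by
  by_cases hv : v = T.root
  · subst hv; exact absurd (mem_anc_root.1 h) hne
  · exact ((mem_anc_iff hv).1 h).resolve_left hne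

theorem eq_of_mem_anc_of_depth_le (h : u ∈ T.anc v) (hd : T.depth v ≤ T.depth u) : u = v := by
  by_cases hv : v = T.root
  · subst hv; exact mem_anc_root.1 h
  · by_contra hne
    have := depth_le_of_mem_anc (mem_anc_parent h hne); have := T.depth_of_ne_root v hv; omega

theorem anc_antisymm (h : u ∈ T.anc v) (h' : v ∈ T.anc u) : u = v :=
  eq_of_mem_anc_of_depth_le h (depth_le_of_mem_anc h')

theorem ne_root_of_mem_anc (h : u ∈ T.anc v) (hne : u ≠ v) : v ≠ T.root := by
  rintro rfl; exact hne (mem_anc_root.1 h)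

theorem card_anc (v : V) : #(T.anc v) = T.depth v + 1 := by
  induction v using T.parent_induction with
  | root => simp [anc_root, T.depth_root]
  | step v hv ih =>
    rw [anc_eq_insert hv, card_insert_of_notMem (notMem_anc_parent hv), ih,
      T.depth_of_ne_root v hv]

theorem anc_total (hu : u ∈ T.anc w) (hv : v ∈ T.anc w) : u ∈ T.anc v ∨ v ∈ T.anc u := by
  induction w using T.parent_induction with
  | root => rw [mem_anc_root.1 hu]; exact Or.inl (root_mem_anc v)
  | step w hw ih =>
    rcases (mem_anc_iff hw).1 hu with rfl | hu'
    · exact Or.inr hv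
    · rcases (mem_anc_iff hw).1 hv with rfl | hv'
      · exact Or.inl hu
      · exact ih hu' hv'

theorem eq_of_mem_anc_of_depth_eq (hu : u ∈ T.anc w) (hv : v ∈ T.anc w)
    (h : T.depth u = T.depth v) : u = v := by
  rcases anc_total hu hv with h' | h'
  · exact eq_of_mem_anc_of_depth_le h' h.ge
  · exact (eq_of_mem_anc_of_depth_le h' h.le).symm

theorem exists_child_mem_anc (h : u ∈ T.anc v) (hne : u ≠ v) :
    ∃ c ∈ T.anc v, c ≠ T.root ∧ T.parent c = u := by
  induction v using T.parent_induction with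
  | root => exact absurd (mem_anc_root.1 h) hne
  | step v hv ih =>
    by_cases hu : u = T.parent v
    · exact ⟨v, self_mem_anc v, hv, hu.symm⟩
    · obtain ⟨c, hc, hcr, hcu⟩ := ih (mem_anc_parent h hne) hu
      exact ⟨c, anc_parent_subset v hc, hcr, hcu⟩

theorem child_unique (hc : c ∈ T.anc w) (hd : d ∈ T.anc w) (hc' : c ≠ T.root)
    (hd' : d ≠ T.root) (h : T.parent c = T.parent d) : c = d :=
  eq_of_mem_anc_of_depth_eq hc hd (by rw [T.depth_of_ne_root c hc', T.depth_of_ne_root d hd', h])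

theorem child_mem_anc (hc : c ∈ T.anc w) (hv : v ∈ T.anc w) (h : T.parent c ∈ T.anc v)
    (hne : v ≠ T.parent c) : c ∈ T.anc v := by
  rcases anc_total hc hv with h' | h'
  · exact h'
  · by_cases hvc : v = c
    · subst hvc; exact self_mem_anc _
    · exact absurd (anc_antisymm (mem_anc_parent h' hvc) h) hne

theorem exists_descendant_of_step {P R : V → Prop} {B : ℕ} (bound : ∀ v, P v → T.depth v ≤ B)
    (step : ∀ v, P v → ¬R v → ∃ c, c ≠ T.root ∧ T.parent c = v ∧ P c) (hv : P v) :
    ∃ q, R q ∧ v ∈ T.anc q ∧ ∀ e ∈ T.anc q, v ∈ T.anc e → P e := by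
  induction h : B - T.depth v generalizing v with
  | zero =>
    by_cases hR : R v
    · exact ⟨v, hR, self_mem_anc v, fun e he he' => anc_antisymm he he' ▸ hv⟩
    · obtain ⟨c, hcr, rfl, hc⟩ := step v hv hR
      have := bound c hc; have := T.depth_of_ne_root c hcr; omega
  | succ n ih =>
    by_cases hR : R v
    · exact ⟨v, hR, self_mem_anc v, fun e he he' => anc_antisymm he he' ▸ hv⟩
    obtain ⟨c, hcr, rfl, hc⟩ := step v hv hR
    obtain ⟨q, hq, hcq, hP⟩ := ih hc (by have := T.depth_of_ne_root c hcr; omega)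
    refine ⟨q, hq, anc_subset hcq (parent_mem_anc c), fun e he he' => ?_⟩
    by_cases hec : e = T.parent c
    · exact hec ▸ hv
    · exact hP e he (child_mem_anc hcq he he' hec)

/-- The length of the path between two nodes. -/
def dist (T : ParentTree V) (u v : V) : ℕ := #(symmDiff (T.anc u) (T.anc v))

theorem dist_self (v : V) : T.dist v v = 0 := by simp [dist]

theorem dist_comm (u v : V) : T.dist u v = T.dist v u := by rw [dist, dist, symmDiff_comm]

theorem dist_triangle (u v w : V) : T.dist u w ≤ T.dist u v + T.dist v w :=
  (card_le_card (symmDiff_triangle (T.anc u) (T.anc v) (T.anc w))).trans (card_union_le _ _)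

theorem dist_parent_add_one (h : c ∉ T.anc a) : T.dist (T.parent c) a + 1 = T.dist c a := by
  have hc : c ≠ T.root := by rintro rfl; exact h (root_mem_anc a)
  have : symmDiff (T.anc c) (T.anc a) = insert c (symmDiff (T.anc (T.parent c)) (T.anc a)) := by
    ext x
    simp only [anc_eq_insert hc, mem_symmDiff, mem_insert]
    grind
  have hmem : c ∉ symmDiff (T.anc (T.parent c)) (T.anc a) := by
    simp [mem_symmDiff, h, notMem_anc_parent hc]
  rw [dist, dist, this, card_insert_of_notMem hmem]

theorem dist_add_one_eq_dist_parent (hc : c ≠ T.root) (h : c ∈ T.anc a) :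
    T.dist c a + 1 = T.dist (T.parent c) a := by
  have : symmDiff (T.anc (T.parent c)) (T.anc a) = insert c (symmDiff (T.anc c) (T.anc a)) := by
    have := notMem_anc_parent hc
    ext x
    simp only [anc_eq_insert hc, mem_symmDiff, mem_insert]
    grind
  have hmem : c ∉ symmDiff (T.anc c) (T.anc a) := by simp [mem_symmDiff, h, self_mem_anc]
  rw [dist, dist, this, card_insert_of_notMem hmem]

end ParentTree

section PathSystem

variable {V E ι : Type*} [DecidableEq E] (P : V → Finset E)

/-- For a path `P v` of edges to each node `v`: the number of indices in `s` that `f` places at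
nodes whose path contains `e`. -/
def load (s : Finset ι) (f : ι → V) (e : E) : ℕ := #{i ∈ s | e ∈ P (f i)}

/-- The total number of edges that the path to `v` shares with the paths to the `f i`, `i ∈ s`. -/
def overlap (s : Finset ι) (f : ι → V) (v : V) : ℕ := ∑ i ∈ s, #(P v ∩ P (f i))

/-- The cost of moving a robot from `u` to `v` when the other robots `s` are placed by `α`: three
times the increase of the overlap, plus the number of edges that the robot leaves to others. -/
def moveCost (s : Finset ι) (α : ι → V) (u v : V) : ℤ :=
  3 * ((overlap P s α v : ℤ) - overlap P s α u) + #{e ∈ P u \ P v | 0 < load P s α e}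

variable {P} {Q : V → Finset E} {s : Finset ι} {f g : ι → V} {i : ι} {e : E} {u v : V}

theorem overlap_eq_sum_load (s : Finset ι) (f : ι → V) (v : V) :
    overlap P s f v = ∑ e ∈ P v, load P s f e := by
  simp only [overlap, load, card_filter, ← filter_mem_eq_inter]
  rw [sum_comm]

theorem overlap_sub_overlap (s : Finset ι) (f : ι → V) (u v : V) :
    (overlap P s f v : ℤ) - overlap P s f u =
      ∑ e ∈ P v \ P u, (load P s f e : ℤ) - ∑ e ∈ P u \ P v, (load P s f e : ℤ) := by
  rw [overlap_eq_sum_load, overlap_eq_sum_load]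
  push_cast
  rw [← sum_sdiff_sub_sum_sdiff]

theorem overlap_congr (h : ∀ i ∈ s, f i = g i) (v : V) : overlap P s f v = overlap P s g v :=
  sum_congr rfl fun i hi => by rw [h i hi]

theorem moveCost_congr (h : ∀ i ∈ s, P (f i) = Q (f i)) (hu : P u = Q u) (hv : P v = Q v) :
    moveCost P s f u v = moveCost Q s f u v := by
  have hoverlap : ∀ w, P w = Q w → overlap P s f w = overlap Q s f w := fun w hw =>
    sum_congr rfl fun i hi => by rw [h i hi, hw]
  have hload : ∀ e, load P s f e = load Q s f e := fun e =>
    congrArg card (filter_congr fun i hi => by rw [h i hi])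
  simp only [moveCost, hoverlap u hu, hoverlap v hv, hload, hu, hv]

variable [DecidableEq ι]

theorem load_erase_add_one (hi : i ∈ s) (he : e ∈ P (f i)) :
    load P (s.erase i) f e + 1 = load P s f e := by
  rw [load, load, filter_erase, card_erase_add_one]
  exact mem_filter.2 ⟨hi, he⟩

theorem load_erase_of_notMem (he : e ∉ P (f i)) : load P (s.erase i) f e = load P s f e := by
  rw [load, load, filter_erase, erase_eq_of_notMem]
  exact fun h => he (mem_filter.1 h).2

variable [Fintype ι]

variable (P) in
/-- The energy `∑ₑ xₑ (xₑ - 1)` of a placement `f`, where `xₑ` is the load of the edge `e`. -/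
def energy (f : ι → V) : ℕ := ∑ i, overlap P (univ.erase i) f (f i)

theorem energy_eq_two_mul_overlap_add (f : ι → V) (i : ι) :
    energy P f = 2 * overlap P (univ.erase i) f (f i) +
      ∑ j ∈ univ.erase i, overlap P ((univ.erase i).erase j) f (f j) := by
  have split : ∀ j ∈ univ.erase i, overlap P (univ.erase j) f (f j) =
      #(P (f i) ∩ P (f j)) + overlap P ((univ.erase i).erase j) f (f j) := by
    intro j hj
    have hij : i ∈ univ.erase j := by simpa using (ne_of_mem_erase hj).symm
    rw [overlap, overlap, ← add_sum_erase _ _ hij, erase_right_comm, inter_comm]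
  rw [energy, ← add_sum_erase _ _ (mem_univ i), sum_congr rfl split, sum_add_distrib, ← add_assoc,
    two_mul]
  rfl

theorem energy_update (f : ι → V) (i : ι) (v : V) :
    (energy P (Function.update f i v) : ℤ) = energy P f +
      2 * ((overlap P (univ.erase i) f v : ℤ) - overlap P (univ.erase i) f (f i)) := by
  have others : ∀ s ⊆ univ.erase i, ∀ j ∈ s, Function.update f i v j = f j := fun s hs j hj =>
    Function.update_of_ne (ne_of_mem_erase (hs hj)) _ _
  have rest : ∑ j ∈ univ.erase i, overlap P ((univ.erase i).erase j) (Function.update f i v)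
      (Function.update f i v j) =
      ∑ j ∈ univ.erase i, overlap P ((univ.erase i).erase j) f (f j) :=
    sum_congr rfl fun j hj => by
      rw [others _ Subset.rfl j hj, overlap_congr (others _ (erase_subset _ _))]
  rw [energy_eq_two_mul_overlap_add f i, energy_eq_two_mul_overlap_add (Function.update f i v) i,
    Function.update_self, rest, overlap_congr (others _ Subset.rfl)]
  push_cast; ring

theorem energy_mono (h : ∀ i j, #(P (f i) ∩ P (f j)) ≤ #(Q (g i) ∩ Q (g j))) :
    energy P f ≤ energy Q g :=
  sum_le_sum fun i _ => sum_le_sum fun j _ => h i j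

theorem energy_congr (h : ∀ i j, i ≠ j → #(P (f i) ∩ P (f j)) = #(Q (g i) ∩ Q (g j))) :
    energy P f = energy Q g :=
  sum_congr rfl fun i _ => sum_congr rfl fun j hj => h i j (ne_of_mem_erase hj).symm

theorem energy_le {b : ℕ} (h : ∀ i, #(P (f i)) ≤ b) :
    energy P f ≤ Fintype.card ι * (Fintype.card ι * b) :=
  calc energy P f ≤ ∑ _i : ι, ∑ _j : ι, b :=
        sum_le_sum fun i _ => (sum_le_sum_of_subset (subset_univ _)).trans <|
          sum_le_sum fun j _ => (card_le_card inter_subset_right).trans (h j)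
    _ = Fintype.card ι * (Fintype.card ι * b) := by simp

theorem overlap_erase_sub_overlap_erase (f : ι → V) (i : ι) (v : V) :
    (overlap P (univ.erase i) f (f i) : ℤ) - overlap P (univ.erase i) f v =
      ∑ e ∈ P (f i) \ P v, ((load P univ f e : ℤ) - 1) -
        ∑ e ∈ P v \ P (f i), (load P univ f e : ℤ) := by
  rw [overlap_sub_overlap]
  congr 1 <;> refine sum_congr rfl fun e he => ?_
  · rw [← load_erase_add_one (mem_univ i) (mem_sdiff.1 he).1]; push_cast; ring
  · rw [load_erase_of_notMem (mem_sdiff.1 he).2]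

/-- An edge-by-edge comparison of loads, to be used with robots placed by `α`, tokens placed by `f`,
and `a = 3` tokens per robot. -/
theorem mul_overlap_sub_overlap_add_card_le {κ : Type*} {α : κ → V} {s : Finset κ} {a : ℤ}
    (gain : ∀ e ∈ P (f i) \ P u, a * load P s α e ≤ load P univ f e - 1)
    (loss : ∀ e ∈ P u \ P (f i),
      (load P univ f e : ℤ) + (if 0 < load P s α e then 1 else 0) ≤ a * load P s α e) :
    a * ((overlap P s α (f i) : ℤ) - overlap P s α u) +
        #{e ∈ P u \ P (f i) | 0 < load P s α e} ≤
      (overlap P (univ.erase i) f (f i) : ℤ) - overlap P (univ.erase i) f u := by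
  rw [overlap_sub_overlap, overlap_erase_sub_overlap_erase, mul_sub, mul_sum, mul_sum, card_filter]
  have hgain := sum_le_sum gain
  have hloss := sum_le_sum loss
  rw [sum_add_distrib] at hloss
  push_cast
  linarith

end PathSystem

section Feasible

variable {V E ι κ : Type*} [DecidableEq V] [DecidableEq E] [Fintype κ]
variable {s : Finset ι} {α : ι → V} {β : κ → V} {Q : Finset V} {i : ι} {v : V}

/-- A placement `β` of tokens is feasible when outside the set `Q` of open nodes no node carries
more tokens than there are robots of `s`, placed by `α`. -/
def Feasible (s : Finset ι) (α : ι → V) (Q : Finset V) (β : κ → V) : Prop :=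
  ∀ v ∉ Q, #{t | β t = v} ≤ #{j ∈ s | α j = v}

theorem feasible_const {q : V} (hq : q ∈ Q) : Feasible s α Q fun _ : κ => q := by
  intro v hv
  rw [filter_false_of_mem fun t _ (h : q = v) => hv (h ▸ hq)]
  simp

theorem Feasible.mono {s' : Finset ι} (h : Feasible s α Q β) (hs : s ⊆ s') :
    Feasible s' α Q β :=
  fun v hv => (h v hv).trans (card_le_card (filter_subset_filter _ hs))

variable [Fintype ι] [DecidableEq ι]

theorem feasible_update_iff (hv : v ∈ Q) :
    Feasible univ (Function.update α i v) Q β ↔ Feasible (univ.erase i) α Q β := by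
  refine forall₂_congr fun w hw => ?_
  have hvw : v ≠ w := fun h => hw (h ▸ hv)
  have : ({j | Function.update α i v j = w} : Finset ι) = {j ∈ univ.erase i | α j = w} := by
    ext j
    by_cases hj : j = i <;> simp [hj, hvw]
  rw [this]

theorem Feasible.update [DecidableEq κ] (h : Feasible (univ.erase i) α Q β)
    (t : κ) : Feasible univ α Q (Function.update β t (α i)) := by
  intro w hw
  by_cases hwi : α i = w
  · have hsub : ({t' | Function.update β t (α i) t' = w} : Finset κ) ⊆
        insert t ({t' | β t' = w} : Finset κ) := fun t' ht' => by
      by_cases htt : t' = t <;> simp_all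
    have hi : #{j ∈ univ.erase i | α j = w} + 1 = #{j | α j = w} := by
      rw [filter_erase, card_erase_add_one (mem_filter.2 ⟨mem_univ i, hwi⟩)]
    have := (card_le_card hsub).trans (card_insert_le _ _)
    have := h w hw
    omega
  · have hsub : ({t' | Function.update β t (α i) t' = w} : Finset κ) ⊆
        ({t' | β t' = w} : Finset κ) :=
      fun t' ht' => by by_cases htt : t' = t <;> simp_all
    exact (card_le_card hsub).trans (h.mono (erase_subset i univ) w hw)

variable {P : V → Finset E}

variable (P) in
/-- The least energy of a feasible placement of three tokens per robot. -/
noncomputable def minEnergy (α : ι → V) (Q : Finset V) : ℕ :=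
  sInf {e | ∃ β : Fin 3 × ι → V, Feasible univ α Q β ∧ energy P β = e}

theorem exists_energy_eq_minEnergy (α : ι → V) (hQ : Q.Nonempty) :
    ∃ β : Fin 3 × ι → V, Feasible univ α Q β ∧ energy P β = minEnergy P α Q := by
  obtain ⟨q, hq⟩ := hQ
  exact Nat.sInf_mem (s := {e | ∃ β : Fin 3 × ι → V, Feasible univ α Q β ∧ energy P β = e})
    ⟨_, _, feasible_const hq, rfl⟩

theorem minEnergy_le_energy {β : Fin 3 × ι → V} (h : Feasible univ α Q β) :
    minEnergy P α Q ≤ energy P β :=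
  Nat.sInf_le ⟨β, h, rfl⟩

end Feasible

namespace ParentTree

section Tokens

variable {V ι κ : Type*} [DecidableEq V] (T : ParentTree V)

/-- The subtree spanned by `Q` and the root. When `Q` is the set of open nodes, these are the nodes
with an open node below them. -/
def span (Q : Finset V) : Finset V := Q.biUnion T.anc

/-- The children of `v` in the subtree spanned by `S`. -/
def childrenIn (S : Finset V) (v : V) : Finset V := {c ∈ T.span S | c ≠ T.root ∧ T.parent c = v}

/-- How far the number of tokens below `v` exceeds three times the number of robots below `v`. -/
def surplus [Fintype κ] (s : Finset ι) (α : ι → V) (β : κ → V) (v : V) : ℤ :=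
  load T.anc univ β v - 3 * load T.anc s α v

variable {T} {s : Finset ι} {α : ι → V} {Q S : Finset V} {c v : V}

theorem mem_span : v ∈ T.span Q ↔ ∃ q ∈ Q, v ∈ T.anc q := mem_biUnion

theorem mem_span_of_mem_anc (h : v ∈ T.anc c) (hc : c ∈ T.span Q) : v ∈ T.span Q := by
  obtain ⟨q, hq, hcq⟩ := mem_span.1 hc
  exact mem_span.2 ⟨q, hq, anc_subset hcq h⟩

theorem mem_childrenIn : c ∈ T.childrenIn S v ↔ c ∈ T.span S ∧ c ≠ T.root ∧ T.parent c = v := by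
  rw [childrenIn, mem_filter]

theorem load_eq_card_add_sum_childrenIn (hS : ∀ i ∈ s, α i ∈ S) (v : V) :
    load T.anc s α v = #{i ∈ s | α i = v} + ∑ c ∈ T.childrenIn S v, load T.anc s α c := by
  simp only [load, card_filter]
  rw [sum_comm, ← sum_add_distrib]
  refine sum_congr rfl fun i hi => ?_
  by_cases hv : v ∈ T.anc (α i)
  · by_cases he : α i = v
    · rw [if_pos hv, if_pos he, sum_eq_zero, add_zero]
      intro c hc
      obtain ⟨-, hcr, rfl⟩ := mem_childrenIn.1 hc
      rw [he, if_neg (notMem_anc_parent hcr)]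
    · obtain ⟨c, hc, hcr, hcv⟩ := exists_child_mem_anc hv (Ne.symm he)
      have hcS : c ∈ T.childrenIn S v := mem_childrenIn.2 ⟨mem_span.2 ⟨_, hS i hi, hc⟩, hcr, hcv⟩
      rw [if_pos hv, if_neg he, zero_add, sum_eq_single_of_mem c hcS, if_pos hc]
      intro d hd hdc
      obtain ⟨-, hdr, hdv⟩ := mem_childrenIn.1 hd
      exact if_neg fun hd' => hdc (child_unique hd' hc hdr hcr (hdv.trans hcv.symm))
  · have he : α i ≠ v := by rintro rfl; exact hv (self_mem_anc _)
    rw [if_neg hv, if_neg he, sum_eq_zero, add_zero]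
    intro c hc
    obtain ⟨-, -, rfl⟩ := mem_childrenIn.1 hc
    exact if_neg fun h => hv (anc_subset h (parent_mem_anc c))

theorem load_pos_of_mem_span (hQ : Q ⊆ s.image α) (hv : v ∈ T.span Q) : 0 < load T.anc s α v := by
  obtain ⟨q, hq, hvq⟩ := mem_span.1 hv
  obtain ⟨j, hj, rfl⟩ := mem_image.1 (hQ hq)
  exact card_pos.2 ⟨j, mem_filter.2 ⟨hj, hvq⟩⟩

theorem card_filter_le_of_card_fiber_le {f : ι → V} {t : Finset κ} {g : κ → V} {p : V → Prop}
    [DecidablePred p] (h : ∀ v, p v → #{i ∈ s | f i = v} ≤ #{j ∈ t | g j = v}) :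
    #{i ∈ s | p (f i)} ≤ #{j ∈ t | p (g j)} := by
  have : (s.val.map f).filter p ≤ (t.val.map g).filter p := by
    refine Multiset.le_iff_count.2 fun v => ?_
    rw [Multiset.count_filter, Multiset.count_filter]
    split_ifs with hv
    · simpa [Multiset.count_map, eq_comm, Finset.card, filter_val] using h v hv
    · exact le_rfl
  simpa [Multiset.filter_map, Finset.card, filter_val, Function.comp_def] using
    Multiset.card_le_card this

variable [Fintype κ] {β : κ → V}

theorem load_le_load_of_notMem_span (hβ : Feasible s α Q β) (hv : v ∉ T.span Q) :
    load T.anc univ β v ≤ load T.anc s α v :=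
  card_filter_le_of_card_fiber_le (p := fun w => v ∈ T.anc w) fun w hw =>
    hβ w fun hwQ => hv (mem_span.2 ⟨w, hwQ, hw⟩)

theorem surplus_nonpos_of_notMem_span (hβ : Feasible s α Q β) (hv : v ∉ T.span Q) :
    T.surplus s α β v ≤ 0 := by
  have := load_le_load_of_notMem_span hβ hv
  rw [surplus]; omega

theorem surplus_add_card_le_sum_surplus (hβ : Feasible s α Q β) (hv : ¬ (v ∈ Q ∧ ∃ t, β t = v)) :
    T.surplus s α β v + #{i ∈ s | α i = v} ≤
      ∑ c ∈ T.childrenIn (univ.image β ∪ s.image α) v, T.surplus s α β c := by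
  have hloc : #{t | β t = v} ≤ #{i ∈ s | α i = v} := by
    by_cases hvQ : v ∈ Q
    · rw [filter_false_of_mem fun t _ ht => hv ⟨hvQ, t, ht⟩]
      exact Nat.zero_le _
    · exact hβ v hvQ
  simp only [surplus]
  rw [sum_sub_distrib, ← mul_sum,
    load_eq_card_add_sum_childrenIn (α := β) (S := univ.image β ∪ s.image α)
      (fun t _ => mem_union_left _ (mem_image_of_mem β (mem_univ t))),
    load_eq_card_add_sum_childrenIn (α := α) (S := univ.image β ∪ s.image α)
      (fun i hi => mem_union_right _ (mem_image_of_mem α hi))]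
  push_cast
  omega

theorem exists_child_surplus_pos (hβ : Feasible s α Q β) (hv : ¬ (v ∈ Q ∧ ∃ t, β t = v))
    (hs : 0 < T.surplus s α β v) : ∃ c, c ≠ T.root ∧ T.parent c = v ∧ 0 < T.surplus s α β c := by
  by_contra! h
  have hle := surplus_add_card_le_sum_surplus (T := T) hβ hv
  have := sum_nonpos fun c (hc : c ∈ T.childrenIn (univ.image β ∪ s.image α) v) =>
    h c (mem_childrenIn.1 hc).2.1 (mem_childrenIn.1 hc).2.2
  omega

theorem exists_child_surplus_pos_of_surplus_neg (hβ : Feasible s α Q β)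
    (hv : ¬ (v ∈ Q ∧ ∃ t, β t = v)) (hs : 0 ≤ T.surplus s α β v)
    (hd : c ∈ T.span (univ.image β ∪ s.image α)) (hdr : c ≠ T.root) (hdv : T.parent c = v)
    (hneg : T.surplus s α β c < 0) :
    ∃ c, c ≠ T.root ∧ T.parent c = v ∧ 0 < T.surplus s α β c := by
  by_contra! h
  have hle := surplus_add_card_le_sum_surplus (T := T) hβ hv
  have := sum_neg' (fun c hc => h c (mem_childrenIn.1 hc).2.1 (mem_childrenIn.1 hc).2.2)
    ⟨c, mem_childrenIn.2 ⟨hd, hdr, hdv⟩, hneg⟩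
  omega

theorem exists_child_mem_span_surplus_nonneg (hβ : Feasible s α Q β) (hQ : Q ⊆ s.image α)
    (hv : ¬ (v ∈ Q ∧ ∃ t, β t = v)) (hvS : v ∈ T.span Q) (hs : 0 ≤ T.surplus s α β v) :
    ∃ c, c ≠ T.root ∧ T.parent c = v ∧ c ∈ T.span Q ∧ 0 ≤ T.surplus s α β c := by
  by_contra! h
  have hle := surplus_add_card_le_sum_surplus (T := T) hβ hv
  have hnonpos : ∀ c ∈ T.childrenIn (univ.image β ∪ s.image α) v, T.surplus s α β c ≤ 0 := by
    intro c hc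
    obtain ⟨-, hcr, hcv⟩ := mem_childrenIn.1 hc
    by_cases hcS : c ∈ T.span Q
    · exact (h c hcr hcv hcS).le
    · exact surplus_nonpos_of_notMem_span hβ hcS
  obtain ⟨q, hq, hvq⟩ := mem_span.1 hvS
  by_cases hqv : v = q
  · subst hqv
    obtain ⟨j, hj, hjv⟩ := mem_image.1 (hQ hq)
    have : 0 < #{i ∈ s | α i = v} := card_pos.2 ⟨j, mem_filter.2 ⟨hj, hjv⟩⟩
    have := sum_nonpos hnonpos
    omega
  · obtain ⟨c, hc, hcr, hcv⟩ := exists_child_mem_anc hvq hqv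
    have hcS : c ∈ T.span (univ.image β ∪ s.image α) :=
      mem_span.2 ⟨q, mem_union_right _ (hQ hq), hc⟩
    have := sum_neg' hnonpos ⟨c, mem_childrenIn.2 ⟨hcS, hcr, hcv⟩,
      h c hcr hcv (mem_span.2 ⟨q, hq, hc⟩)⟩
    omega

theorem exists_token_of_surplus_pos (hβ : Feasible s α Q β) (hs : 0 < T.surplus s α β v) :
    ∃ t, β t ∈ Q ∧ v ∈ T.anc (β t) ∧
      ∀ e ∈ T.anc (β t), v ∈ T.anc e → 0 < T.surplus s α β e := by
  have bound : ∀ v, 0 < T.surplus s α β v → T.depth v ≤ (univ.image β).sup T.depth := by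
    intro v hv
    have hpos : 0 < load T.anc univ β v := by rw [surplus] at hv; omega
    obtain ⟨t, ht⟩ := card_pos.1 hpos
    exact (depth_le_of_mem_anc (mem_filter.1 ht).2).trans (le_sup (mem_image_of_mem β (mem_univ t)))
  obtain ⟨q, ⟨hq, t, rfl⟩, hvq, hpath⟩ := exists_descendant_of_step bound
    (R := fun v => v ∈ Q ∧ ∃ t, β t = v)
    (fun v hv hR => exists_child_surplus_pos hβ hR hv) hs
  exact ⟨t, hq, hvq, hpath⟩

theorem exists_token_of_surplus_nonneg (hβ : Feasible s α Q β) (hQ : Q ⊆ s.image α)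
    (hvS : v ∈ T.span Q) (hs : 0 ≤ T.surplus s α β v) :
    ∃ t, β t ∈ Q ∧ v ∈ T.anc (β t) ∧
      ∀ e ∈ T.anc (β t), v ∈ T.anc e → 0 ≤ T.surplus s α β e := by
  have bound : ∀ v, v ∈ T.span Q ∧ 0 ≤ T.surplus s α β v → T.depth v ≤ Q.sup T.depth := by
    rintro v ⟨hv, -⟩
    obtain ⟨q, hq, hvq⟩ := mem_span.1 hv
    exact (depth_le_of_mem_anc hvq).trans (le_sup hq)
  obtain ⟨q, ⟨hq, t, rfl⟩, hvq, hpath⟩ := exists_descendant_of_step bound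
    (R := fun v => v ∈ Q ∧ ∃ t, β t = v)
    (fun v hv hR => exists_child_mem_span_surplus_nonneg hβ hQ hR hv.1 hv.2) ⟨hvS, hs⟩
  exact ⟨t, hq, hvq, fun e he hve => (hpath e he hve).2⟩

theorem exists_deepest_surplus_nonneg (hcard : 3 * #s ≤ Fintype.card κ) (hne : Q.Nonempty) (u : V) :
    ∃ w ∈ T.anc u, w ∈ T.span Q ∧ 0 ≤ T.surplus s α β w ∧
      ∀ e ∈ T.anc u, e ∉ T.anc w → e ∈ T.span Q → T.surplus s α β e < 0 := by
  have hroot : T.root ∈ {e ∈ T.anc u | e ∈ T.span Q ∧ 0 ≤ T.surplus s α β e} := by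
    obtain ⟨q, hq⟩ := hne
    refine mem_filter.2 ⟨root_mem_anc u, mem_span.2 ⟨q, hq, root_mem_anc q⟩, ?_⟩
    simp only [surplus, load, root_mem_anc, filter_true, card_univ]
    omega
  obtain ⟨w, hw, hmax⟩ := exists_max_image _ T.depth ⟨_, hroot⟩
  obtain ⟨hwu, hwS, hws⟩ := mem_filter.1 hw
  refine ⟨w, hwu, hwS, hws, fun e heu hew heS => ?_⟩
  by_contra! hes
  refine hew ?_
  rw [eq_of_mem_anc_of_depth_le ((anc_total hwu heu).resolve_right hew)
    (hmax e (mem_filter.2 ⟨heu, heS, hes⟩))]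
  exact self_mem_anc e

variable [DecidableEq κ]

/-- The subtree of `w` that contains `e` has negative surplus, so another child of `w` has positive
surplus, and from there one descends to the token along edges of positive surplus. -/
theorem exists_token_moveCost_le {u w e : V} (hβ : Feasible s α Q β) (hQ : Q ⊆ s.image α)
    (hwu : w ∈ T.anc u) (hws : 0 ≤ T.surplus s α β w)
    (hmax : ∀ e ∈ T.anc u, e ∉ T.anc w → e ∈ T.span Q → T.surplus s α β e < 0)
    (heu : e ∈ T.anc u) (hew : e ∉ T.anc w) (heS : e ∈ T.span Q) :
    ∃ t, β t ∈ Q ∧ moveCost T.anc s α u (β t) ≤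
      overlap T.anc (univ.erase t) β (β t) - overlap T.anc (univ.erase t) β u := by
  obtain ⟨t, htQ, hwt, hpos⟩ : ∃ t, β t ∈ Q ∧ w ∈ T.anc (β t) ∧
      ∀ e ∈ T.anc (β t) \ T.anc u, 0 < T.surplus s α β e := by
    by_cases hw : w ∈ Q ∧ ∃ t, β t = w
    · obtain ⟨hwQ, t, rfl⟩ := hw
      refine ⟨t, hwQ, self_mem_anc _, fun e he => ?_⟩
      exact absurd (anc_subset hwu (mem_sdiff.1 he).1) (mem_sdiff.1 he).2
    have hwe : w ∈ T.anc e := (anc_total hwu heu).resolve_right hew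
    obtain ⟨d, hde, hdr, rfl⟩ := exists_child_mem_anc hwe fun h => hew (h ▸ self_mem_anc _)
    have hdS := mem_span_of_mem_anc hde heS
    have hdneg := hmax d (anc_subset heu hde) (notMem_anc_parent hdr) hdS
    obtain ⟨q, hq, hdq⟩ := mem_span.1 hdS
    obtain ⟨c, -, hcw, hc⟩ := exists_child_surplus_pos_of_surplus_neg hβ hw hws
      (mem_span.2 ⟨q, mem_union_right _ (hQ hq), hdq⟩) hdr rfl hdneg
    obtain ⟨t, htQ, hct, hpath⟩ := exists_token_of_surplus_pos hβ hc
    have hwt : T.parent d ∈ T.anc (β t) := hcw ▸ anc_subset hct (parent_mem_anc c)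
    refine ⟨t, htQ, hwt, fun e he => ?_⟩
    obtain ⟨het, heu⟩ := mem_sdiff.1 he
    have hew : e ∉ T.anc (T.parent d) := fun h => heu (anc_subset hwu h)
    refine hpath e het (child_mem_anc hct het ?_ ?_) <;> rw [hcw]
    · exact (anc_total hwt het).resolve_right hew
    · rintro rfl; exact hew (self_mem_anc _)
  refine ⟨t, htQ, mul_overlap_sub_overlap_add_card_le (fun e he => ?_) fun e he => ?_⟩
  · have := hpos e he
    rw [surplus] at this; omega
  · obtain ⟨heu, het⟩ := mem_sdiff.1 he
    have hew : e ∉ T.anc w := fun h => het (anc_subset hwt h)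
    by_cases heS : e ∈ T.span Q
    · have := hmax e heu hew heS
      rw [surplus] at this
      split_ifs <;> omega
    · have := load_le_load_of_notMem_span hβ heS
      split_ifs <;> omega

theorem exists_token_two_mul_overlap_add_card_le {u w : V} (hβ : Feasible s α Q β)
    (hQ : Q ⊆ s.image α) (hwu : w ∈ T.anc u) (hwS : w ∈ T.span Q) (hws : 0 ≤ T.surplus s α β w)
    (hdead : ∀ e ∈ T.anc u, e ∉ T.anc w → e ∉ T.span Q) :
    ∃ t, β t ∈ Q ∧ 2 * ((overlap T.anc s α (β t) : ℤ) - overlap T.anc s α u) +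
        #{e ∈ T.anc u \ T.anc (β t) | 0 < load T.anc s α e} ≤
      overlap T.anc (univ.erase t) β (β t) - overlap T.anc (univ.erase t) β u := by
  obtain ⟨t, htQ, hwt, hpath⟩ := exists_token_of_surplus_nonneg hβ hQ hwS hws
  refine ⟨t, htQ, mul_overlap_sub_overlap_add_card_le (fun e he => ?_) fun e he => ?_⟩
  · obtain ⟨het, heu⟩ := mem_sdiff.1 he
    have hew : e ∉ T.anc w := fun h => heu (anc_subset hwu h)
    have hsurplus := hpath e het ((anc_total hwt het).resolve_right hew)
    have := load_pos_of_mem_span hQ (mem_span.2 ⟨_, htQ, het⟩)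
    rw [surplus] at hsurplus; omega
  · obtain ⟨heu, het⟩ := mem_sdiff.1 he
    have := load_le_load_of_notMem_span hβ (hdead e heu fun h => het (anc_subset hwt h))
    split_ifs <;> omega

theorem exists_token_two_mul_moveCost_le (hβ : Feasible s α Q β) (hQ : Q ⊆ s.image α)
    (hcard : 3 * #s ≤ Fintype.card κ) (hne : Q.Nonempty) (u : V) :
    ∃ t, β t ∈ Q ∧ 2 * moveCost T.anc s α u (β t) ≤
      3 * max ((overlap T.anc (univ.erase t) β (β t) : ℤ) -
        overlap T.anc (univ.erase t) β u) 0 := by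
  obtain ⟨w, hwu, hwS, hws, hmax⟩ := exists_deepest_surplus_nonneg (T := T) (α := α) (β := β)
    hcard hne u
  by_cases hopen : ∃ e ∈ T.anc u, e ∉ T.anc w ∧ e ∈ T.span Q
  · obtain ⟨e, heu, hew, heS⟩ := hopen
    obtain ⟨t, htQ, ht⟩ := exists_token_moveCost_le hβ hQ hwu hws hmax heu hew heS
    exact ⟨t, htQ, by omega⟩
  · obtain ⟨t, htQ, ht⟩ := exists_token_two_mul_overlap_add_card_le hβ hQ hwu hwS hws
      fun e heu hew heS => hopen ⟨e, heu, hew, heS⟩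
    exact ⟨t, htQ, by rw [moveCost]; omega⟩

end Tokens

/-- The cost of giving an open node to a robot is paid for by the increase of the least energy:
in an optimal placement after the move, some token can be sent back to the old node of the robot. -/
theorem four_mul_moveCost_le {V ι : Type*} [DecidableEq V] [Fintype ι] [DecidableEq ι]
    {T : ParentTree V} {α : ι → V} {Q : Finset V} {i : ι} {v : V} (hQ : Q ⊆ univ.image α)
    (hi : α i ∉ Q) (hv : v ∈ Q)
    (hmin : ∀ w ∈ Q, moveCost T.anc (univ.erase i) α (α i) v ≤
      moveCost T.anc (univ.erase i) α (α i) w) :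
    4 * moveCost T.anc (univ.erase i) α (α i) v ≤
      3 * ((minEnergy T.anc (Function.update α i v) Q : ℤ) - minEnergy T.anc α Q) := by
  obtain ⟨β, hβ, hβE⟩ := exists_energy_eq_minEnergy (P := T.anc) (Function.update α i v) ⟨v, hv⟩
  rw [feasible_update_iff hv] at hβ
  have hQ' : Q ⊆ (univ.erase i).image α := fun q hq => by
    obtain ⟨j, -, rfl⟩ := mem_image.1 (hQ hq)
    exact mem_image_of_mem α (mem_erase.2 ⟨fun h => hi (h ▸ hq), mem_univ j⟩)
  have hcard : 3 * #(univ.erase i) ≤ Fintype.card (Fin 3 × ι) := by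
    rw [Fintype.card_prod, Fintype.card_fin]
    exact Nat.mul_le_mul_left 3 (card_le_univ _)
  obtain ⟨t, htQ, ht⟩ := exists_token_two_mul_moveCost_le (T := T) hβ hQ' hcard ⟨v, hv⟩ (α i)
  have hkeep := minEnergy_le_energy (P := T.anc) (hβ.mono (erase_subset i univ))
  have hsend := minEnergy_le_energy (P := T.anc) (hβ.update t)
  have hsaved := energy_update (P := T.anc) β t (α i)
  have := hmin _ htQ
  omega

end ParentTree

/-- What the team remembers: the present positions, the visited nodes, the parents and the
ancestors of the visited nodes, and for each robot its anchor, the node whose subtree the robot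
has to explore. -/
structure Memory (k : ℕ) where
  pos : Fin k → ℕ
  visited : Finset ℕ
  parent : ℕ → ℕ
  anc : ℕ → Finset ℕ
  anchor : Fin k → ℕ

namespace Memory

variable {k : ℕ}

/-- The memory before the first round. -/
def start (c : Fin k → ℕ) : Memory k where
  pos := c
  visited := univ.image c
  parent v := v
  anc v := {v}
  anchor := c

/-- There is no dangling edge: exploration is over and the robots may return. -/
def Explored (H : SimpleGraph ℕ) (m : Memory k) : Prop :=
  ∀ v ∈ m.visited, ∀ a, H.Adj v a → a ∈ m.visited

open Classical in
/-- The child of `u` on the path to `v` (junk value `u` if `v` is not strictly below `u`). -/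
noncomputable def childToward (parent : ℕ → ℕ) (anc : ℕ → Finset ℕ) (u v : ℕ) : ℕ :=
  if h : ∃ c ∈ anc v, c ≠ u ∧ parent c = u then h.choose else u

/-- The dangling edges at the position of robot `i`, given by their unvisited endpoints. -/
def dangling (H : SimpleGraph ℕ) (m : Memory k) (i : Fin k) : Set ℕ :=
  {a | H.Adj (m.pos i) a ∧ a ∉ m.visited}

open Classical in
/-- The number of robots with smaller index than robot `i` at the node of robot `i`. -/
noncomputable def rank (m : Memory k) (i : Fin k) : ℕ :=
  Nat.count (fun n => ∃ h : n < k, m.pos ⟨n, h⟩ = m.pos i) i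

open Classical in
/-- The instruction for robot `i`. When everything is explored, return to the root. A robot in the
subtree of its anchor takes a dangling edge of its own, or else goes up to the anchor; other robots
go to their anchor. -/
noncomputable def instruction (H : SimpleGraph ℕ) (m : Memory k) (i : Fin k) : Option ℕ :=
  if m.Explored H then some (m.parent (m.pos i))
  else if m.anchor i ∈ m.anc (m.pos i) then
    if m.rank i < (m.dangling H i).ncard then some (Nat.nth (· ∈ m.dangling H i) (m.rank i))
    else if m.pos i = m.anchor i then none else some (m.parent (m.pos i))
  else if m.pos i ∈ m.anc (m.anchor i) then
    some (childToward m.parent m.anc (m.pos i) (m.anchor i))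
  else some (m.parent (m.pos i))

/-- The visited nodes when the robots have moved to `c`. -/
def visitedAfter (m : Memory k) (c : Fin k → ℕ) : Finset ℕ := m.visited ∪ univ.image c

open Classical in
/-- The parents of the visited nodes when the robots have moved to `c`: a node is entered for the
first time from its parent. -/
noncomputable def parentAfter (m : Memory k) (c : Fin k → ℕ) (v : ℕ) : ℕ :=
  if v ∈ m.visited then m.parent v else if h : ∃ i, c i = v then m.pos h.choose else v

open Classical in
/-- The ancestors of the visited nodes when the robots have moved to `c`. -/
noncomputable def ancAfter (m : Memory k) (c : Fin k → ℕ) (v : ℕ) : Finset ℕ :=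
  if v ∈ m.visited then m.anc v
  else if h : ∃ i, c i = v then insert v (m.anc (m.pos h.choose)) else ∅

/-- The anchor `q` is closed when one of its robots is there and finds no dangling edge. -/
def Closing (H : SimpleGraph ℕ) (m : Memory k) (c : Fin k → ℕ) (q : ℕ) : Prop :=
  (∃ i, m.anchor i = q ∧ c i = q) ∧ ∀ a, H.Adj q a → a ∈ m.visitedAfter c

open Classical in
/-- The anchors after closing: when an anchor is closed, a robot strictly below it is anchored at
the child of the old anchor that is above the robot. -/
noncomputable def lowered (H : SimpleGraph ℕ) (m : Memory k) (c : Fin k → ℕ) (i : Fin k) : ℕ :=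
  if m.Closing H c (m.anchor i) ∧ m.anchor i ∈ m.ancAfter c (c i) ∧ c i ≠ m.anchor i then
    childToward (m.parentAfter c) (m.ancAfter c) (m.anchor i) (c i)
  else m.anchor i

open Classical in
/-- The anchors that remain open after closing. -/
noncomputable def openAnchors (H : SimpleGraph ℕ) (m : Memory k) (c : Fin k → ℕ) : Finset ℕ :=
  {q ∈ univ.image (m.lowered H c) | ¬ m.Closing H c q}

open Classical in
/-- An open anchor of least cost for robot `i` (junk value `α i` if `Q` is empty). -/
noncomputable def cheapest (anc : ℕ → Finset ℕ) (Q : Finset ℕ) (α : Fin k → ℕ) (i : Fin k) : ℕ :=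
  if h : ∃ v ∈ Q, ∀ w ∈ Q,
      moveCost anc (univ.erase i) α (α i) v ≤ moveCost anc (univ.erase i) α (α i) w then
    h.choose else α i

/-- Give an open anchor to robot `i` if it has none. -/
noncomputable def reanchor (anc : ℕ → Finset ℕ) (Q : Finset ℕ) (α : Fin k → ℕ) (i : Fin k) :
    Fin k → ℕ :=
  if α i ∈ Q then α else Function.update α i (cheapest anc Q α i)

/-- The memory after the robots have moved to `c`. -/
noncomputable def advance (H : SimpleGraph ℕ) (m : Memory k) (c : Fin k → ℕ) : Memory k where
  pos := c
  visited := m.visitedAfter c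
  parent := m.parentAfter c
  anc := m.ancAfter c
  anchor := (List.finRange k).foldl (reanchor (m.ancAfter c) (m.openAnchors H c)) (m.lowered H c)

/-- The memory reconstructed from the history of the positions, latest first. -/
noncomputable def ofHistory (H : SimpleGraph ℕ) : List (Fin k → ℕ) → Memory k
  | [] => start fun _ => 0
  | [c] => start c
  | c :: c' :: l => advance H (ofHistory H (c' :: l)) c

open Classical in
/-- The positions after the next round. -/
noncomputable def next (H : SimpleGraph ℕ) (m : Memory k) (i : Fin k) : ℕ :=
  match m.instruction H i with
  | none => m.pos i
  | some a => if H.Adj (m.pos i) a then a else m.pos i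

/-- The memory after `t` rounds of an exploration of `H` that starts at `c`. -/
noncomputable def process (H : SimpleGraph ℕ) (c : Fin k → ℕ) (t : ℕ) : Memory k :=
  (fun m => m.advance H (m.next H))^[t] (start c)

theorem process_succ (H : SimpleGraph ℕ) (c : Fin k → ℕ) (t : ℕ) :
    process H c (t + 1) = (process H c t).advance H ((process H c t).next H) :=
  Function.iterate_succ_apply' _ _ _

open Classical in
theorem advance_congr {H H' : SimpleGraph ℕ} (m : Memory k) {c : Fin k → ℕ}
    (h : ∀ i a, H.Adj (c i) a ↔ H'.Adj (c i) a) : m.advance H c = m.advance H' c := by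
  have hclosing : m.Closing H c = m.Closing H' c := by
    funext q
    refine propext (and_congr_right ?_)
    rintro ⟨i, -, rfl⟩
    exact forall_congr' fun a => by rw [h]
  have hlowered : m.lowered H c = m.lowered H' c := by
    funext i; simp only [lowered, hclosing]
  simp only [advance, openAnchors, hclosing, hlowered]

open Classical in
theorem instruction_congr {H H' : SimpleGraph ℕ} (m : Memory k) (hp : ∀ i, m.pos i ∈ m.visited)
    (h : ∀ v ∈ m.visited, ∀ a, H.Adj v a ↔ H'.Adj v a) : m.instruction H = m.instruction H' := by
  have hexplored : m.Explored H = m.Explored H' :=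
    propext (forall₂_congr fun v hv => forall_congr' fun a => by rw [h v hv])
  have hdangling : m.dangling H = m.dangling H' := by
    funext i; ext a; simp only [dangling, Set.mem_ofPred_eq, h _ (hp i)]
  funext i
  simp only [instruction, hexplored, hdangling]

end Memory

/-- The exploration algorithm: each robot follows the instruction computed from the memory. -/
noncomputable def explorer (k : ℕ) : Algorithm k := fun K =>
  (Memory.ofHistory K.map K.history).instruction K.map

/-- The graph `H` is the tree `T` restricted to the finite set `nodes`, which contains the root and
the parents of its elements. -/
structure TreeGraph {V : Type*} (T : ParentTree V) (nodes : Finset V) (H : SimpleGraph V) :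
    Prop where
  root_mem : T.root ∈ nodes
  parent_mem : ∀ v ∈ nodes, T.parent v ∈ nodes
  adj_iff : ∀ u v, H.Adj u v ↔
    u ∈ nodes ∧ v ∈ nodes ∧ (v ≠ T.root ∧ T.parent v = u ∨ u ≠ T.root ∧ T.parent u = v)

theorem TreeGraph.adj_parent {V : Type*} {T : ParentTree V} {nodes : Finset V} {H : SimpleGraph V}
    (hH : TreeGraph T nodes H) {v : V} (hv : v ∈ nodes) (hr : v ≠ T.root) : H.Adj v (T.parent v) :=
  (hH.adj_iff _ _).2 ⟨hv, hH.parent_mem v hv, Or.inr ⟨hr, rfl⟩⟩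

/-- The relation between the anchors `α` and the positions `c` of the robots when `W` is the set of
visited nodes: different anchors are incomparable; a robot is below its own anchor or below no
anchor; no two robots share a node strictly below the anchor of one of them; dangling edges are at
anchors or between a robot and its anchor. -/
structure Anchored {V ι : Type*} [DecidableEq V] (T : ParentTree V) (H : SimpleGraph V)
    (W : Finset V) (c α : ι → V) : Prop where
  antichain : ∀ i j, α i ∈ T.anc (α j) → α i = α j
  below_or_outside : ∀ i, α i ∈ T.anc (c i) ∨ ∀ j, α j ∉ T.anc (c i)
  eq_of_mem : ∀ i j x, x ∈ T.anc (c i) → x ∈ T.anc (c j) → α i ∈ T.anc x → x ≠ α i → i = j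
  dangling : ∀ v ∈ W, ∀ a, H.Adj v a → a ∉ W →
    (∃ i, α i = v) ∨ ∃ i, α i ∈ T.anc v ∧ v ∈ T.anc (c i)

/-- The possible moves from `p` to `p'` of a robot with anchor `a`, where `W` and `W'` are the sets
of visited nodes before and after the round. -/
inductive RoundMove {V : Type*} [DecidableEq V] (T : ParentTree V) (H : SimpleGraph V)
    (W W' : Finset V) (p a p' : V) : Prop
  | explore (below : a ∈ T.anc p) (new : p' ∉ W) (adj : H.Adj p p') (ne : p' ≠ T.root)
      (parent : T.parent p' = p)
  | up (below : a ∈ T.anc p) (ne : p ≠ a) (done : ∀ b, H.Adj p b → b ∈ W) (eq : p' = T.parent p)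
  | stay (at_anchor : p = a) (done : ∀ b, H.Adj p b → b ∈ W') (eq : p' = p)
  | down (not_below : a ∉ T.anc p) (mem : p' ∈ T.anc a) (ne : p' ≠ T.root)
      (parent : T.parent p' = p)
  | back (not_below : a ∉ T.anc p) (not_above : p ∉ T.anc a) (eq : p' = T.parent p)

theorem RoundMove.of_notMem {V : Type*} [DecidableEq V] {T : ParentTree V} {H : SimpleGraph V}
    {W W' : Finset V} {p a p' : V} (h : RoundMove T H W W' p a p') (hp : T.anc p ⊆ W)
    (ha : T.anc a ⊆ W) (hnew : p' ∉ W) :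
    a ∈ T.anc p ∧ H.Adj p p' ∧ p' ≠ T.root ∧ T.parent p' = p := by
  cases h with
  | explore below new adj ne parent => exact ⟨below, adj, ne, parent⟩
  | up below ne done eq => exact absurd (eq ▸ hp (ParentTree.parent_mem_anc p)) hnew
  | stay at_anchor done eq => exact absurd (eq ▸ hp (ParentTree.self_mem_anc p)) hnew
  | down not_below mem ne parent => exact absurd (ha mem) hnew
  | back not_below not_above eq => exact absurd (eq ▸ hp (ParentTree.parent_mem_anc p)) hnew

namespace Memory

variable {k : ℕ} {T : ParentTree ℕ} {nodes : Finset ℕ} {H : SimpleGraph ℕ} {m : Memory k}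
  {i j : Fin k}

/-- The memory is correct about the visited part of the tree. -/
structure Sound (T : ParentTree ℕ) (nodes : Finset ℕ) (m : Memory k) : Prop where
  visited_subset : m.visited ⊆ nodes
  root_mem : T.root ∈ m.visited
  parent_mem : ∀ v ∈ m.visited, T.parent v ∈ m.visited
  pos_mem : ∀ i, m.pos i ∈ m.visited
  anchor_mem : ∀ i, m.anchor i ∈ m.visited
  parent_eq : ∀ v ∈ m.visited, m.parent v = T.parent v
  anc_eq : ∀ v ∈ m.visited, m.anc v = T.anc v

theorem Sound.anc_subset (hm : m.Sound T nodes) {v : ℕ} (hv : v ∈ m.visited) :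
    T.anc v ⊆ m.visited := by
  induction v using T.parent_induction with
  | root => simpa only [ParentTree.anc_root, singleton_subset_iff] using hv
  | step v hne ih =>
    rw [ParentTree.anc_eq_insert hne]
    exact insert_subset hv (ih (hm.parent_mem v hv))

theorem Sound.anc_pos (hm : m.Sound T nodes) (i : Fin k) : m.anc (m.pos i) = T.anc (m.pos i) :=
  hm.anc_eq _ (hm.pos_mem i)

theorem Sound.anc_anchor (hm : m.Sound T nodes) (i : Fin k) :
    m.anc (m.anchor i) = T.anc (m.anchor i) :=
  hm.anc_eq _ (hm.anchor_mem i)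

theorem Sound.adj_parent_pos (hm : m.Sound T nodes) (hH : TreeGraph T nodes H)
    (hr : m.pos i ≠ T.root) : H.Adj (m.pos i) (T.parent (m.pos i)) :=
  hH.adj_parent (hm.visited_subset (hm.pos_mem i)) hr

theorem Sound.parent_eq_of_adj (hm : m.Sound T nodes) (hH : TreeGraph T nodes H) {v a : ℕ}
    (hv : v ∈ m.visited) (ha : a ∉ m.visited) (h : H.Adj v a) : a ≠ T.root ∧ T.parent a = v := by
  rcases ((hH.adj_iff _ _).1 h).2.2 with h | h
  · exact h
  · exact absurd (h.2 ▸ hm.parent_mem v hv) ha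

theorem childToward_spec {parent : ℕ → ℕ} {anc : ℕ → Finset ℕ} {u v : ℕ}
    (hparent : ∀ w ∈ T.anc v, parent w = T.parent w) (hanc : anc v = T.anc v) (h : u ∈ T.anc v)
    (hne : u ≠ v) : childToward parent anc u v ∈ T.anc v ∧
      childToward parent anc u v ≠ T.root ∧ T.parent (childToward parent anc u v) = u := by
  have hex : ∃ c ∈ anc v, c ≠ u ∧ parent c = u := by
    obtain ⟨c, hc, hroot, rfl⟩ := ParentTree.exists_child_mem_anc h hne
    exact ⟨c, hanc ▸ hc, (ParentTree.parent_ne_self hroot).symm, hparent c hc⟩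
  rw [childToward, dif_pos hex]
  obtain ⟨hmem, hne', heq⟩ := hex.choose_spec
  have hmem' : hex.choose ∈ T.anc v := hanc ▸ hmem
  rw [hparent _ hmem'] at heq
  refine ⟨hmem', fun hroot => hne' ?_, heq⟩
  rw [hroot, T.parent_root] at heq
  exact hroot.trans heq

section Rank

theorem finite_dangling (hH : TreeGraph T nodes H) (m : Memory k) (i : Fin k) :
    (m.dangling H i).Finite :=
  nodes.finite_toSet.subset fun _ ha => ((hH.adj_iff _ _).1 ha.1).2.1

theorem dangling_congr (h : m.pos i = m.pos j) : m.dangling H i = m.dangling H j := by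
  rw [dangling, dangling, h]

theorem nth_mem_dangling (hH : TreeGraph T nodes H) (h : m.rank i < (m.dangling H i).ncard) :
    Nat.nth (· ∈ m.dangling H i) (m.rank i) ∈ m.dangling H i := by
  rw [Set.ncard_eq_toFinset_card _ (finite_dangling hH m i)] at h
  exact Nat.nth_mem_of_lt_card (finite_dangling hH m i) h

theorem exists_rank_eq {n : ℕ} (h : n < m.rank i) : ∃ j, m.pos j = m.pos i ∧ m.rank j = n := by
  classical
  set p : ℕ → Prop := fun n => ∃ h : n < k, m.pos ⟨n, h⟩ = m.pos i
  have hcard : ∀ hf : (Set.ofPred p).Finite, n < #hf.toFinset := by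
    intro hf
    refine h.trans_le ?_
    rw [rank, Nat.count_eq_card_filter_range]
    exact card_le_card fun x hx => (Set.Finite.mem_toFinset _).2 (mem_filter.1 hx).2
  obtain ⟨hlt, hj⟩ : p (Nat.nth p n) := Nat.nth_mem n hcard
  refine ⟨⟨_, hlt⟩, hj, ?_⟩
  rw [rank]
  simp only [hj]
  convert Nat.count_nth hcard

theorem rank_injective (hp : m.pos i = m.pos j) (h : m.rank i = m.rank j) : i = j := by
  classical
  rw [rank, rank, hp] at h
  exact Fin.ext (Nat.count_injective ⟨i.2, hp⟩ ⟨j.2, rfl⟩ h)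

theorem rank_eq_zero (h : ∀ j, m.pos j = m.pos i → j = i) : m.rank i = 0 := by
  by_contra hne
  obtain ⟨j, hj, hr⟩ := exists_rank_eq (Nat.pos_of_ne_zero hne)
  rw [h j hj] at hr
  exact hne hr

theorem rank_eq_zero_of_below_anchor (hA : Anchored T H m.visited m.pos m.anchor)
    (ha : m.anchor i ∈ T.anc (m.pos i))
    (hpa : m.pos i ≠ m.anchor i) : m.rank i = 0 :=
  rank_eq_zero fun j hj => (hA.eq_of_mem i j (m.pos i) (ParentTree.self_mem_anc _)
    (hj ▸ ParentTree.self_mem_anc _) ha hpa).symm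

end Rank

section Next

theorem next_of_lt_rank (hH : TreeGraph T nodes H) (hm : m.Sound T nodes) (hne : ¬ m.Explored H)
    (ha : m.anchor i ∈ T.anc (m.pos i)) (hr : m.rank i < (m.dangling H i).ncard) :
    m.next H i = Nat.nth (· ∈ m.dangling H i) (m.rank i) := by
  simp only [next, instruction, if_neg hne, hm.anc_pos, if_pos ha, if_pos hr,
    if_pos (nth_mem_dangling hH hr).1]

theorem next_of_eq_anchor (hm : m.Sound T nodes) (hne : ¬ m.Explored H)
    (ha : m.pos i = m.anchor i) (hr : ¬ m.rank i < (m.dangling H i).ncard) :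
    m.next H i = m.pos i := by
  have hbelow : m.anchor i ∈ T.anc (m.pos i) := ha ▸ ParentTree.self_mem_anc _
  simp only [next, instruction, if_neg hne, hm.anc_pos, if_pos hbelow, if_neg hr, if_pos ha]

theorem next_of_below_anchor (hH : TreeGraph T nodes H) (hm : m.Sound T nodes)
    (hne : ¬ m.Explored H) (ha : m.anchor i ∈ T.anc (m.pos i)) (hpa : m.pos i ≠ m.anchor i)
    (hr : ¬ m.rank i < (m.dangling H i).ncard) : m.next H i = T.parent (m.pos i) := by
  have hadj := hm.adj_parent_pos hH (ParentTree.ne_root_of_mem_anc ha hpa.symm)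
  simp only [next, instruction, if_neg hne, hm.anc_pos, if_pos ha, if_neg hr, if_neg hpa,
    if_pos hadj, hm.parent_eq _ (hm.pos_mem i)]

theorem next_of_above_anchor (hH : TreeGraph T nodes H) (hm : m.Sound T nodes)
    (hne : ¬ m.Explored H) (ha : m.anchor i ∉ T.anc (m.pos i))
    (hp : m.pos i ∈ T.anc (m.anchor i)) :
    m.next H i ∈ T.anc (m.anchor i) ∧ m.next H i ≠ T.root ∧ T.parent (m.next H i) = m.pos i := by
  obtain ⟨hmem, hroot, hparent⟩ := childToward_spec
    (fun w hw => hm.parent_eq w (hm.anc_subset (hm.anchor_mem i) hw)) (hm.anc_anchor i) hp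
    fun h => ha (h ▸ ParentTree.self_mem_anc _)
  have hadj := hH.adj_parent (hm.visited_subset (hm.anc_subset (hm.anchor_mem i) hmem)) hroot
  rw [hparent] at hadj
  have hnext : m.next H i = childToward m.parent m.anc (m.pos i) (m.anchor i) := by
    simp only [next, instruction, if_neg hne, hm.anc_pos, hm.anc_anchor, if_neg ha, if_pos hp,
      if_pos hadj.symm]
  exact hnext ▸ ⟨hmem, hroot, hparent⟩

theorem next_of_outside_anchor (hH : TreeGraph T nodes H) (hm : m.Sound T nodes)
    (hne : ¬ m.Explored H) (ha : m.anchor i ∉ T.anc (m.pos i))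
    (hp : m.pos i ∉ T.anc (m.anchor i)) : m.next H i = T.parent (m.pos i) := by
  have hadj := hm.adj_parent_pos hH (i := i) fun h => hp (h ▸ ParentTree.root_mem_anc _)
  simp only [next, instruction, if_neg hne, hm.anc_pos, hm.anc_anchor, if_neg ha, if_neg hp,
    if_pos hadj, hm.parent_eq _ (hm.pos_mem i)]

variable (hH : TreeGraph T nodes H) (hm : m.Sound T nodes)
  (hA : Anchored T H m.visited m.pos m.anchor) (hne : ¬ m.Explored H)

include hH hm hA hne

theorem exists_next_eq_of_dangling (ha : m.anchor i ∈ T.anc (m.pos i))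
    (hr : ¬ m.rank i < (m.dangling H i).ncard) {b : ℕ} (hb : b ∈ m.dangling H i) :
    ∃ j, m.next H j = b := by
  have hfin := finite_dangling hH m i
  obtain ⟨n, hn, hnth⟩ := Nat.exists_lt_card_finite_nth_eq (p := (· ∈ m.dangling H i)) hfin hb
  have hn' : n < (m.dangling H i).ncard := by rwa [Set.ncard_eq_toFinset_card _ hfin]
  obtain ⟨j, hj, rfl⟩ := exists_rank_eq (hn'.trans_le (not_lt.1 hr))
  have haj : m.anchor j ∈ T.anc (m.pos j) :=
    (hA.below_or_outside j).resolve_right fun h => h i (hj ▸ ha)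
  rw [← dangling_congr hj] at hnth hn'
  exact ⟨j, (next_of_lt_rank hH hm hne haj hn').trans hnth⟩

theorem roundMove (i : Fin k) : RoundMove T H m.visited (m.visitedAfter (m.next H)) (m.pos i)
    (m.anchor i) (m.next H i) := by
  by_cases ha : m.anchor i ∈ T.anc (m.pos i)
  · by_cases hr : m.rank i < (m.dangling H i).ncard
    · obtain ⟨hadj, hnew⟩ := next_of_lt_rank hH hm hne ha hr ▸ nth_mem_dangling hH hr
      obtain ⟨hroot, hparent⟩ := hm.parent_eq_of_adj hH (hm.pos_mem i) hnew hadj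
      exact .explore ha hnew hadj hroot hparent
    by_cases hpa : m.pos i = m.anchor i
    · refine .stay hpa (fun b hb => ?_) (next_of_eq_anchor hm hne hpa hr)
      by_cases hbv : b ∈ m.visited
      · exact mem_union_left _ hbv
      · obtain ⟨j, rfl⟩ := exists_next_eq_of_dangling hH hm hA hne ha hr ⟨hb, hbv⟩
        exact mem_union_right _ (mem_image_of_mem _ (mem_univ j))
    · refine .up ha hpa (fun b hb => ?_) (next_of_below_anchor hH hm hne ha hpa hr)
      by_contra hbv
      refine hr ?_
      rw [rank_eq_zero_of_below_anchor hA ha hpa]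
      exact (Set.ncard_pos (finite_dangling hH m i)).2 ⟨b, hb, hbv⟩
  · by_cases hpa : m.pos i ∈ T.anc (m.anchor i)
    · obtain ⟨hmem, hroot, hparent⟩ := next_of_above_anchor hH hm hne ha hpa
      exact .down ha hmem hroot hparent
    · exact .back ha hpa (next_of_outside_anchor hH hm hne ha hpa)

theorem of_next_notMem_visited (hi : m.next H i ∉ m.visited) :
    m.anchor i ∈ T.anc (m.pos i) ∧ H.Adj (m.pos i) (m.next H i) ∧ m.next H i ≠ T.root ∧
      T.parent (m.next H i) = m.pos i :=
  (roundMove hH hm hA hne i).of_notMem (hm.anc_subset (hm.pos_mem i))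
    (hm.anc_subset (hm.anchor_mem i)) hi

theorem lt_rank_of_next_notMem_visited (hi : m.next H i ∉ m.visited) :
    m.rank i < (m.dangling H i).ncard := by
  by_contra hr
  have ha := (of_next_notMem_visited hH hm hA hne hi).1
  by_cases hpa : m.pos i = m.anchor i
  · exact hi (next_of_eq_anchor hm hne hpa hr ▸ hm.pos_mem i)
  · exact hi (next_of_below_anchor hH hm hne ha hpa hr ▸ hm.parent_mem _ (hm.pos_mem i))

theorem eq_of_next_eq (hi : m.next H i ∉ m.visited) (hij : m.next H i = m.next H j) : i = j := by
  obtain ⟨hai, -, -, hpi⟩ := of_next_notMem_visited hH hm hA hne hi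
  obtain ⟨haj, -, -, hpj⟩ := of_next_notMem_visited hH hm hA hne (hij ▸ hi)
  have hri := lt_rank_of_next_notMem_visited hH hm hA hne hi
  have hrj := lt_rank_of_next_notMem_visited hH hm hA hne (hij ▸ hi)
  have hp : m.pos i = m.pos j := by rw [← hpi, hij, hpj]
  rw [next_of_lt_rank hH hm hne hai hri, next_of_lt_rank hH hm hne haj hrj,
    dangling_congr hp] at hij
  have hfin := finite_dangling hH m j
  rw [dangling_congr hp, Set.ncard_eq_toFinset_card _ hfin] at hri
  rw [Set.ncard_eq_toFinset_card _ hfin] at hrj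
  exact rank_injective hp (Nat.nth_injOn (p := (· ∈ m.dangling H j)) hfin hri hrj hij)

end Next

end Memory

section Moves

variable {V ι : Type*} [DecidableEq V] {T : ParentTree V} {H : SimpleGraph V} {W W' : Finset V}
  {c c' α : ι → V} {p a b p' x : V}

open ParentTree

theorem RoundMove.mem_anc_or_eq (h : RoundMove T H W W' p a p') (hx : x ∈ T.anc p')
    (hb : b ∈ T.anc x) (hxb : x ≠ b) (hanti : b ∈ T.anc a → b = a) :
    x ∈ T.anc p ∨ x ∉ W ∧ x = p' := by
  cases h with
  | explore below new adj ne parent =>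
    rcases (mem_anc_iff ne).1 hx with rfl | hx
    · exact Or.inr ⟨new, rfl⟩
    · exact Or.inl (parent ▸ hx)
  | up below ne done eq => exact Or.inl (anc_parent_subset _ (eq ▸ hx))
  | stay at_anchor done eq => exact Or.inl (eq ▸ hx)
  | down not_below mem ne parent =>
    have hxa := anc_subset mem hx
    obtain rfl := hanti (anc_subset hxa hb)
    exact absurd (anc_antisymm hxa hb) hxb
  | back not_below not_above eq => exact Or.inl (anc_parent_subset _ (eq ▸ hx))

variable (hA : Anchored T H W c α) (hmove : ∀ i, RoundMove T H W W' (c i) (α i) (c' i))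

include hA hmove

theorem Anchored.below_or_outside_of_roundMove (i : ι) :
    α i ∈ T.anc (c' i) ∨ ∀ j, α j ∉ T.anc (c' i) := by
  cases hmove i with
  | explore below new adj ne parent =>
    exact Or.inl (anc_subset (parent_mem_anc _) (parent ▸ below))
  | up below ne done eq => exact Or.inl (eq ▸ mem_anc_parent below ne.symm)
  | stay at_anchor done eq => exact Or.inl (by rw [eq, at_anchor]; exact self_mem_anc _)
  | down not_below mem ne parent =>
    by_cases he : ∃ j, α j ∈ T.anc (c' i)
    · obtain ⟨j, hj⟩ := he
      exact Or.inl (hA.antichain j i (anc_subset mem hj) ▸ hj)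
    · exact Or.inr (not_exists.1 he)
  | back not_below not_above eq =>
    exact Or.inr fun j hj => (hA.below_or_outside i).resolve_left not_below j
      (anc_parent_subset _ (eq ▸ hj))

variable (hc : ∀ i, T.anc (c i) ⊆ W)

include hc

theorem Anchored.eq_of_mem_of_roundMove (hinj : ∀ i j, c' i ∉ W → c' i = c' j → i = j) {i j : ι}
    (hi : x ∈ T.anc (c' i)) (hj : x ∈ T.anc (c' j)) (ha : α i ∈ T.anc x) (hxa : x ≠ α i) :
    i = j := by
  rcases (hmove i).mem_anc_or_eq hi ha hxa (hA.antichain i i) with hi | ⟨hxW, hxi⟩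
  · rcases (hmove j).mem_anc_or_eq hj ha hxa (hA.antichain i j) with hj | ⟨hxW, -⟩
    · exact hA.eq_of_mem i j x hi hj ha hxa
    · exact absurd (hc i hi) hxW
  · rcases (hmove j).mem_anc_or_eq hj ha hxa (hA.antichain i j) with hj | ⟨-, hxj⟩
    · exact absurd (hc j hj) hxW
    · exact hinj i j (hxi ▸ hxW) (hxi.symm.trans hxj)

variable (hα : ∀ i, T.anc (α i) ⊆ W)

include hα

theorem Anchored.dangling_of_roundMove (hW : W ⊆ W') (hW' : ∀ v ∈ W', v ∉ W → ∃ i, c' i = v)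
    (hx : x ∈ W') (hadj : H.Adj x a) (ha : a ∉ W') :
    (∃ i, α i = x) ∨ ∃ i, α i ∈ T.anc x ∧ x ∈ T.anc (c' i) := by
  have haW : a ∉ W := fun h => ha (hW h)
  by_cases hxW : x ∈ W
  · refine (hA.dangling x hxW a hadj haW).imp_right ?_
    rintro ⟨i, hi, hxi⟩
    refine ⟨i, hi, ?_⟩
    cases hmove i with
    | explore below new adj ne parent => exact anc_parent_subset _ (by rw [parent]; exact hxi)
    | up below ne done eq =>
      rw [eq]
      refine mem_anc_parent hxi ?_
      rintro rfl
      exact haW (done a hadj)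
    | stay at_anchor done eq => exact eq ▸ hxi
    | down not_below mem ne parent => exact absurd (anc_subset hxi hi) not_below
    | back not_below not_above eq => exact absurd (anc_subset hxi hi) not_below
  · obtain ⟨i, rfl⟩ := hW' x hx hxW
    obtain ⟨hbelow, -, -, hparent⟩ := (hmove i).of_notMem (hc i) (hα i) hxW
    exact Or.inr ⟨i, anc_subset (parent_mem_anc _) (hparent ▸ hbelow), self_mem_anc _⟩

theorem Anchored.of_roundMove (hW : W ⊆ W') (hW' : ∀ v ∈ W', v ∉ W → ∃ i, c' i = v)
    (hinj : ∀ i j, c' i ∉ W → c' i = c' j → i = j) : Anchored T H W' c' α where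
  antichain := hA.antichain
  below_or_outside := hA.below_or_outside_of_roundMove hmove
  eq_of_mem _ _ _ := hA.eq_of_mem_of_roundMove hmove hc hinj
  dangling _ hx _ := hA.dangling_of_roundMove hmove hc hα hW hW' hx

end Moves

/-- The change of anchors from `α` to `α'` when those satisfying `Z` are closed: a robot strictly
below its closed anchor gets the next node on its path as new anchor. The new anchors that are not
closed form the set `Q`. -/
structure Lowering {V ι : Type*} [DecidableEq V] (T : ParentTree V) (Z : V → Prop) (Q : Finset V)
    (c α α' : ι → V) : Prop where
  of_strict : ∀ i, Z (α i) → α i ∈ T.anc (c i) → c i ≠ α i →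
    α' i ∈ T.anc (c i) ∧ α' i ≠ T.root ∧ T.parent (α' i) = α i
  of_not : ∀ i, ¬ (Z (α i) ∧ α i ∈ T.anc (c i) ∧ c i ≠ α i) → α' i = α i
  closing : ∀ q, Z q → ∃ i, α i = q
  mem_open : ∀ q, q ∈ Q ↔ (∃ i, α' i = q) ∧ ¬ Z q

namespace Lowering

variable {V ι : Type*} [DecidableEq V] {T : ParentTree V} {Z : V → Prop} {W Q : Finset V}
  {c α α' α'' : ι → V} {i : ι} {q v x a : V}

open ParentTree

theorem lowered_or_eq (hL : Lowering T Z Q c α α') (i : ι) :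
    (Z (α i) ∧ α i ∈ T.anc (c i) ∧ c i ≠ α i ∧
      α' i ∈ T.anc (c i) ∧ α' i ≠ T.root ∧ T.parent (α' i) = α i) ∨
    ¬ (Z (α i) ∧ α i ∈ T.anc (c i) ∧ c i ≠ α i) ∧ α' i = α i := by
  by_cases h : Z (α i) ∧ α i ∈ T.anc (c i) ∧ c i ≠ α i
  · exact Or.inl ⟨h.1, h.2.1, h.2.2, hL.of_strict i h.1 h.2.1 h.2.2⟩
  · exact Or.inr ⟨h, hL.of_not i h⟩

theorem mem_anc (hL : Lowering T Z Q c α α') (i : ι) : α i ∈ T.anc (α' i) := by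
  rcases hL.lowered_or_eq i with ⟨-, -, -, -, -, h⟩ | ⟨-, h⟩
  · exact h ▸ parent_mem_anc _
  · exact h ▸ self_mem_anc _

theorem open_cases (hL : Lowering T Z Q c α α') (hq : q ∈ Q) :
    ∃ i, α' i = q ∧ (α i = q ∨ Z (α i) ∧ q ≠ T.root ∧ T.parent q = α i) := by
  obtain ⟨⟨i, rfl⟩, -⟩ := (hL.mem_open q).1 hq
  refine ⟨i, rfl, ?_⟩
  rcases hL.lowered_or_eq i with ⟨hz, -, -, -, hroot, hparent⟩ | ⟨-, h⟩
  · exact Or.inr ⟨hz, hroot, hparent⟩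
  · exact Or.inl h.symm

variable (hL : Lowering T Z Q c α α')

include hL

section Antichain

variable (hanti : ∀ i j, α i ∈ T.anc (α j) → α i = α j)

include hanti

theorem open_notMem_anc (hx : (∀ j, α j ∉ T.anc x) ∨ Z x) (hq : q ∈ Q) : q ∉ T.anc x := by
  intro hqx
  obtain ⟨i, hi, hcases⟩ := hL.open_cases hq
  have hix : α i ∈ T.anc x := anc_subset hqx (hi ▸ hL.mem_anc i)
  rcases hx with hx | hx
  · exact hx i hix
  · obtain ⟨j, rfl⟩ := hL.closing x hx
    rw [← hanti i j hix] at hx hqx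
    rcases hcases with rfl | ⟨-, hroot, hparent⟩
    · exact ((hL.mem_open _).1 hq).2 hx
    · exact notMem_anc_parent hroot (hparent ▸ hqx)

theorem mem_open_of_strict (h : Z (α i) → α i ∈ T.anc (c i) ∧ c i ≠ α i) : α' i ∈ Q := by
  refine (hL.mem_open _).2 ⟨⟨i, rfl⟩, fun hz => ?_⟩
  rcases hL.lowered_or_eq i with ⟨-, -, -, -, hroot, hparent⟩ | ⟨hnot, heq⟩
  · obtain ⟨j, hj⟩ := hL.closing _ hz
    have heq : α i = α' i := hj ▸ hanti i j (hj ▸ hL.mem_anc i)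
    exact parent_ne_self hroot (hparent.trans heq)
  · rw [heq] at hz
    exact hnot ⟨hz, h hz⟩

theorem of_notMem_open (h : α' i ∉ Q) :
    α' i = α i ∧ Z (α i) ∧ (α i ∉ T.anc (c i) ∨ c i = α i) := by
  have hz : Z (α i) ∧ ¬ (α i ∈ T.anc (c i) ∧ c i ≠ α i) := by
    by_contra hcon
    exact h (hL.mem_open_of_strict hanti (by tauto))
  exact ⟨hL.of_not i fun h' => hz.2 h'.2, hz.1, by tauto⟩

theorem eq_of_mem_anc_of_mem_open {q' : V} (hq : q ∈ Q) (hq' : q' ∈ Q) (h : q ∈ T.anc q') :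
    q = q' := by
  obtain ⟨i, hi, hcases⟩ := hL.open_cases hq
  obtain ⟨j, -, hcases'⟩ := hL.open_cases hq'
  have hiq : α i ∈ T.anc q := hi ▸ hL.mem_anc i
  have hzq := ((hL.mem_open q).1 hq).2
  have hzq' := ((hL.mem_open q').1 hq').2
  rcases hcases' with rfl | ⟨hzj, hroot', hparent'⟩
  · have hij := hanti i j (anc_subset h hiq)
    rcases hcases with rfl | ⟨hzi, -, -⟩
    · exact hij
    · exact absurd (hij ▸ hzi) hzq'
  · have hij : α i = α j := by
      rcases (mem_anc_iff hroot').1 (anc_subset h hiq) with hiq' | hmem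
      · exact (hanti j i (by rw [hiq', ← hparent']; exact parent_mem_anc _)).symm
      · exact hanti i j (hparent' ▸ hmem)
    rcases hcases with rfl | ⟨-, hroot, hparent⟩
    · exact absurd (hij ▸ hzj) hzq
    · exact child_unique h (self_mem_anc _) hroot hroot' (by rw [hparent, hparent', hij])

end Antichain

variable {H : SimpleGraph V} (hA : Anchored T H W c α)

include hA

theorem open_notMem_anc_pos (hi : α' i ∉ Q) (hq : q ∈ Q) : q ∉ T.anc (c i) := by
  obtain ⟨-, hz, hnot | heq⟩ := hL.of_notMem_open hA.antichain hi
  · exact hL.open_notMem_anc hA.antichain (Or.inl ((hA.below_or_outside i).resolve_left hnot)) hq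
  · exact hL.open_notMem_anc hA.antichain (Or.inr (heq ▸ hz)) hq

theorem below_or_outside (i : ι) : α' i ∈ T.anc (c i) ∨ ∀ q ∈ Q, q ∉ T.anc (c i) := by
  rcases hL.lowered_or_eq i with ⟨-, -, -, hmem, -⟩ | ⟨-, heq⟩
  · exact Or.inl hmem
  · rw [heq]
    exact (hA.below_or_outside i).imp_right fun h _ => hL.open_notMem_anc hA.antichain (Or.inl h)

theorem exists_open_of_dangling (hZ : ∀ q, Z q → ∀ a, H.Adj q a → a ∈ W) (hv : v ∈ W)
    (hadj : H.Adj v a) (ha : a ∉ W) :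
    ∃ i, α' i ∈ Q ∧ (α' i = v ∨ α' i ∈ T.anc v ∧ v ∈ T.anc (c i)) := by
  have hzv : ¬ Z v := fun h => ha (hZ v h a hadj)
  have hold : ∀ i, α i = v → α' i ∈ Q ∧ α' i = v := by
    rintro i rfl
    have heq := hL.of_not i fun h => hzv h.1
    exact ⟨(hL.mem_open _).2 ⟨⟨i, rfl⟩, heq ▸ hzv⟩, heq⟩
  rcases hA.dangling v hv a hadj ha with ⟨i, hi⟩ | ⟨i, hi, hvi⟩
  · exact ⟨i, (hold i hi).imp_right Or.inl⟩
  by_cases hiv : α i = v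
  · exact ⟨i, (hold i hiv).imp_right Or.inl⟩
  have hci : c i ≠ α i := fun h => hiv (anc_antisymm hi (h ▸ hvi))
  refine ⟨i, hL.mem_open_of_strict hA.antichain fun _ => ⟨anc_subset hvi hi, hci⟩,
    Or.inr ⟨?_, hvi⟩⟩
  rcases hL.lowered_or_eq i with ⟨-, -, -, hmem, -, hparent⟩ | ⟨-, heq⟩
  · exact child_mem_anc hmem hvi (hparent ▸ hi) (hparent ▸ Ne.symm hiv)
  · exact heq ▸ hi

theorem anchored (hZ : ∀ q, Z q → ∀ a, H.Adj q a → a ∈ W) (hkeep : ∀ i, α' i ∈ Q → α'' i = α' i)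
    (hopen : ∀ i, α'' i ∈ Q) : Anchored T H W c α'' where
  antichain i j := hL.eq_of_mem_anc_of_mem_open hA.antichain (hopen i) (hopen j)
  below_or_outside i := by
    by_cases hi : α' i ∈ Q
    · rw [hkeep i hi]
      exact (hL.below_or_outside hA i).imp_right fun h j => h _ (hopen j)
    · exact Or.inr fun j => hL.open_notMem_anc_pos hA hi (hopen j)
  eq_of_mem i j x hxi hxj hx hne := by
    by_cases hi : α' i ∈ Q
    · rw [hkeep i hi] at hx hne
      refine hA.eq_of_mem i j x hxi hxj (anc_subset hx (hL.mem_anc i)) ?_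
      rintro rfl
      exact hne (anc_antisymm (hL.mem_anc i) hx)
    · exact absurd (anc_subset hxi hx) (hL.open_notMem_anc_pos hA hi (hopen i))
  dangling v hv a hadj ha := by
    obtain ⟨i, hi, hcases⟩ := hL.exists_open_of_dangling hA hZ hv hadj ha
    rw [← hkeep i hi] at hcases
    exact hcases.imp (fun h => ⟨i, h⟩) fun h => ⟨i, h⟩

end Lowering

namespace Memory

variable {k : ℕ} {T : ParentTree ℕ} {nodes : Finset ℕ} {H : SimpleGraph ℕ} {m : Memory k}
  {c : Fin k → ℕ}

/-- The memory after the robots have moved to `c`, before the anchors are changed. -/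
noncomputable def moved (m : Memory k) (c : Fin k → ℕ) : Memory k where
  pos := c
  visited := m.visitedAfter c
  parent := m.parentAfter c
  anc := m.ancAfter c
  anchor := m.anchor

theorem exists_of_mem_visitedAfter {v : ℕ} (hv : v ∈ m.visitedAfter c) (h : v ∉ m.visited) :
    ∃ i, c i = v := by
  obtain ⟨i, -, hi⟩ := mem_image.1 ((mem_union.1 hv).resolve_left h)
  exact ⟨i, hi⟩

section Moved

variable (hm : m.Sound T nodes)
  (hc : ∀ i, c i ∉ m.visited → c i ∈ nodes ∧ c i ≠ T.root ∧ T.parent (c i) = m.pos i)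

include hm hc

theorem Sound.parentAfter_eq {v : ℕ} (hv : v ∈ m.visitedAfter c) :
    m.parentAfter c v = T.parent v := by
  by_cases h : v ∈ m.visited
  · exact (if_pos h).trans (hm.parent_eq v h)
  · have hex := exists_of_mem_visitedAfter hv h
    have hspec := hex.choose_spec
    rw [parentAfter, if_neg h, dif_pos hex, ← (hc _ (hspec.symm ▸ h)).2.2, hspec]

theorem Sound.ancAfter_eq {v : ℕ} (hv : v ∈ m.visitedAfter c) : m.ancAfter c v = T.anc v := by
  by_cases h : v ∈ m.visited
  · exact (if_pos h).trans (hm.anc_eq v h)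
  · have hex := exists_of_mem_visitedAfter hv h
    have hspec := hex.choose_spec
    obtain ⟨-, hroot, hparent⟩ := hc _ (hspec.symm ▸ h)
    rw [ancAfter, if_neg h, dif_pos hex, hm.anc_pos, ← hparent, hspec,
      ← ParentTree.anc_eq_insert (hspec ▸ hroot)]

theorem Sound.moved : (m.moved c).Sound T nodes where
  visited_subset v hv := by
    by_cases h : v ∈ m.visited
    · exact hm.visited_subset h
    · obtain ⟨i, rfl⟩ := exists_of_mem_visitedAfter hv h
      exact (hc i h).1
  root_mem := mem_union_left _ hm.root_mem
  parent_mem v hv := by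
    refine mem_union_left _ ?_
    by_cases h : v ∈ m.visited
    · exact hm.parent_mem v h
    · obtain ⟨i, rfl⟩ := exists_of_mem_visitedAfter hv h
      exact (hc i h).2.2 ▸ hm.pos_mem i
  pos_mem i := mem_union_right _ (mem_image_of_mem _ (mem_univ i))
  anchor_mem i := mem_union_left _ (hm.anchor_mem i)
  parent_eq _ := hm.parentAfter_eq hc
  anc_eq _ := hm.ancAfter_eq hc

end Moved

theorem Sound.lowering (hs : (m.moved c).Sound T nodes) :
    Lowering T (m.Closing H c) (m.openAnchors H c) c m.anchor (m.lowered H c) where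
  of_strict i hz hmem hne := by
    have hanc : m.ancAfter c (c i) = T.anc (c i) := hs.anc_pos i
    rw [lowered, if_pos ⟨hz, hanc.symm ▸ hmem, hne⟩]
    exact childToward_spec (fun w hw => hs.parent_eq w (hs.anc_subset (hs.pos_mem i) hw)) hanc hmem
      hne.symm
  of_not i h := by
    have hanc : m.ancAfter c (c i) = T.anc (c i) := hs.anc_pos i
    rw [lowered, if_neg (by rwa [hanc])]
  closing := fun _ ⟨⟨i, hi, _⟩, _⟩ => ⟨i, hi⟩
  mem_open q := by simp only [openAnchors, mem_filter, mem_image, mem_univ, true_and]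

section Round

variable (hH : TreeGraph T nodes H) (hm : m.Sound T nodes)
  (hA : Anchored T H m.visited m.pos m.anchor) (hne : ¬ m.Explored H)

include hH hm hA hne

theorem sound_moved_next : (m.moved (m.next H)).Sound T nodes :=
  hm.moved fun _ hi =>
    have ⟨_, hadj, hroot, hparent⟩ := of_next_notMem_visited hH hm hA hne hi
    ⟨((hH.adj_iff _ _).1 hadj).2.1, hroot, hparent⟩

theorem anchored_next : Anchored T H (m.visitedAfter (m.next H)) (m.next H) m.anchor :=
  hA.of_roundMove (roundMove hH hm hA hne) (fun i => hm.anc_subset (hm.pos_mem i))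
    (fun i => hm.anc_subset (hm.anchor_mem i)) subset_union_left
    (fun _ => exists_of_mem_visitedAfter) fun _ _ => eq_of_next_eq hH hm hA hne

end Round

end Memory

theorem sum_apply_update {ι V R : Type*} [Fintype ι] [DecidableEq ι] [AddCommGroup R]
    (f : ι → V → R) (α : ι → V) (i : ι) (v : V) :
    ∑ j, f j (Function.update α i v j) = ∑ j, f j (α j) + (f i v - f i (α i)) := by
  simp only [Function.apply_update f α i v]
  rw [sum_update_of_mem (mem_univ i),
    sum_eq_add_sum_sdiff_singleton_of_mem (mem_univ i) fun j => f j (α j)]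
  abel

section Potential

variable {V ι : Type*} [DecidableEq V] [Fintype ι] {T : ParentTree V}
  {c α : ι → V} {Q : Finset V} {i : ι} {v : V}

open ParentTree

theorem mem_span_image : v ∈ T.span (univ.image α) ↔ ∃ i, v ∈ T.anc (α i) := by
  simp only [mem_span, mem_image, mem_univ, true_and, exists_exists_eq_and]

variable [DecidableEq ι]

variable (T) in
/-- The potential of robots at `c` with anchors `α`, where `Q` is the set of open nodes. The
weights of the distances, of the tree spanned by the anchors, of the depths of the anchors and of
the energies are balanced such that a change of anchors never increases the potential. -/
noncomputable def potential (c : ι → V) (Q : Finset V) (α : ι → V) : ℤ :=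
  ∑ i, (T.dist (c i) (α i) : ℤ) + 3 * #(T.span (univ.image α)) - 2 * ∑ i, (#(T.anc (α i)) : ℤ) -
    3 * ((minEnergy T.anc α Q : ℤ) - 2 * energy T.anc α)

theorem card_span_image_update_add_card_le (hv : ∃ j, j ≠ i ∧ α j = v) :
    #(T.span (univ.image (Function.update α i v))) + #(T.anc (α i) \ T.anc v) ≤
      #(T.span (univ.image α)) +
        #{e ∈ T.anc (α i) \ T.anc v | 0 < load T.anc (univ.erase i) α e} := by
  have others : T.span (univ.image (Function.update α i v)) ⊆
      T.span ((univ.erase i).image α) := by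
    intro e he
    obtain ⟨j, hj⟩ := mem_span_image.1 he
    by_cases hji : j = i
    · obtain ⟨l, hl, rfl⟩ := hv
      rw [hji, Function.update_self] at hj
      exact mem_span.2 ⟨_, mem_image_of_mem α (mem_erase.2 ⟨hl, mem_univ l⟩), hj⟩
    · rw [Function.update_of_ne hji] at hj
      exact mem_span.2 ⟨_, mem_image_of_mem α (mem_erase.2 ⟨hji, mem_univ j⟩), hj⟩
  have unshared : #(T.span ((univ.erase i).image α)) +
      #{e ∈ T.anc (α i) \ T.anc v | ¬ 0 < load T.anc (univ.erase i) α e} ≤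
        #(T.span (univ.image α)) := by
    rw [← card_union_of_disjoint]
    · refine card_le_card (union_subset (biUnion_subset_biUnion_of_subset_left _
        (image_subset_image (erase_subset i univ))) fun e he => ?_)
      exact mem_span_image.2 ⟨i, (mem_sdiff.1 (mem_filter.1 he).1).1⟩
    · exact disjoint_left.2 fun e he he' =>
        (mem_filter.1 he').2 (load_pos_of_mem_span Subset.rfl he)
  rw [← card_filter_add_card_filter_not (s := T.anc (α i) \ T.anc v)
    (fun e => 0 < load T.anc (univ.erase i) α e)]
  have := card_le_card others
  omega

theorem potential_update_add_one_le (hQ : Q ⊆ univ.image α) (hi : α i ∉ Q) (hv : v ∈ Q)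
    (hmin : ∀ w ∈ Q, moveCost T.anc (univ.erase i) α (α i) v ≤
      moveCost T.anc (univ.erase i) α (α i) w)
    (hvi : v ∉ T.anc (α i)) :
    potential T c Q (Function.update α i v) + 1 ≤ potential T c Q α := by
  have hpaid := four_mul_moveCost_le hQ hi hv hmin
  have henergy := energy_update (P := T.anc) α i v
  have hspan : #(T.span (univ.image (Function.update α i v))) + #(T.anc (α i) \ T.anc v) ≤
      #(T.span (univ.image α)) +
        #{e ∈ T.anc (α i) \ T.anc v | 0 < load T.anc (univ.erase i) α e} := by
    obtain ⟨j, -, hj⟩ := mem_image.1 (hQ hv)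
    exact card_span_image_update_add_card_le ⟨j, fun h => hi (h ▸ hj ▸ hv), hj⟩
  have htriangle := T.dist_triangle (c i) (α i) v
  have hdist : T.dist (α i) v = #(T.anc (α i) \ T.anc v) + #(T.anc v \ T.anc (α i)) :=
    card_union_of_disjoint disjoint_sdiff_sdiff
  have hpos : 0 < #(T.anc v \ T.anc (α i)) := card_pos.2 ⟨v, mem_sdiff.2 ⟨self_mem_anc v, hvi⟩⟩
  have hinter := card_sdiff_add_card_inter (T.anc v) (T.anc (α i))
  have hinter' := card_sdiff_add_card_inter (T.anc (α i)) (T.anc v)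
  rw [inter_comm] at hinter'
  unfold potential
  rw [sum_apply_update (fun j x => (T.dist (c j) x : ℤ)),
    sum_apply_update (fun _ x => (#(T.anc x) : ℤ))]
  rw [moveCost] at hpaid
  omega

end Potential

namespace Memory

variable {k : ℕ} {T : ParentTree ℕ} {anc : ℕ → Finset ℕ} {Q : Finset ℕ} {c α : Fin k → ℕ}
  {i j : Fin k}

theorem cheapest_mem (hne : Q.Nonempty) : cheapest anc Q α i ∈ Q := by
  have hex := exists_min_image Q (moveCost anc (univ.erase i) α (α i)) hne
  rw [cheapest, dif_pos hex]
  exact hex.choose_spec.1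

theorem moveCost_cheapest_le {w : ℕ} (hw : w ∈ Q) :
    moveCost anc (univ.erase i) α (α i) (cheapest anc Q α i) ≤
      moveCost anc (univ.erase i) α (α i) w := by
  have hex := exists_min_image Q (moveCost anc (univ.erase i) α (α i)) ⟨w, hw⟩
  rw [cheapest, dif_pos hex]
  exact hex.choose_spec.2 w hw

theorem reanchor_apply_of_mem (h : α j ∈ Q) : reanchor anc Q α i j = α j := by
  rw [reanchor]
  split_ifs with hi
  · rfl
  · exact Function.update_of_ne (by rintro rfl; exact hi h) _ _

theorem reanchor_self_mem (hne : Q.Nonempty) : reanchor anc Q α i i ∈ Q := by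
  rw [reanchor]
  split_ifs with hi
  · exact hi
  · rw [Function.update_self]
    exact cheapest_mem hne

theorem reanchor_mem_or_eq (hne : Q.Nonempty) (i j : Fin k) :
    reanchor anc Q α i j ∈ Q ∨ reanchor anc Q α i j = α j := by
  by_cases hji : j = i
  · exact Or.inl (hji ▸ reanchor_self_mem hne)
  · rw [reanchor]
    split_ifs
    · exact Or.inr rfl
    · exact Or.inr (Function.update_of_ne hji _ _)

theorem foldl_reanchor_apply_of_mem (l : List (Fin k)) (h : α j ∈ Q) :
    l.foldl (reanchor anc Q) α j = α j := by
  induction l generalizing α with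
  | nil => rfl
  | cons i l ih =>
    have hi := reanchor_apply_of_mem (anc := anc) (i := i) h
    rw [List.foldl_cons, ih (hi ▸ h), hi]

theorem foldl_reanchor_apply_mem (hne : Q.Nonempty) {l : List (Fin k)} (h : i ∈ l) :
    l.foldl (reanchor anc Q) α i ∈ Q := by
  induction l generalizing α with
  | nil => exact absurd h List.not_mem_nil
  | cons j l ih =>
    rcases List.mem_cons.1 h with rfl | h
    · rw [List.foldl_cons, foldl_reanchor_apply_of_mem l (reanchor_self_mem hne)]
      exact reanchor_self_mem hne
    · exact ih h

theorem image_foldl_reanchor_finRange (hne : Q.Nonempty) (hQ : Q ⊆ univ.image α) :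
    univ.image ((List.finRange k).foldl (reanchor anc Q) α) = Q := by
  refine Subset.antisymm (image_subset_iff.2 fun i _ =>
    foldl_reanchor_apply_mem hne (List.mem_finRange i)) fun q hq => ?_
  obtain ⟨i, -, rfl⟩ := mem_image.1 (hQ hq)
  exact mem_image.2 ⟨i, mem_univ i, foldl_reanchor_apply_of_mem _ hq⟩

/-- The anchors `α` can be handed out anew with `Q` as the set of open nodes: every open node is an
anchor, the recorded ancestors `anc` of the anchors are correct, and no anchor that is not open is
below an open node. -/
structure Reanchorable (T : ParentTree ℕ) (anc : ℕ → Finset ℕ) (Q : Finset ℕ) (α : Fin k → ℕ) :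
    Prop where
  subset_image : Q ⊆ univ.image α
  anc_eq : ∀ i, anc (α i) = T.anc (α i)
  notMem_anc : ∀ i, α i ∉ Q → ∀ q ∈ Q, q ∉ T.anc (α i)

namespace Reanchorable

variable (h : Reanchorable T anc Q α) (hne : Q.Nonempty)

include h

theorem anc_eq_of_mem {q : ℕ} (hq : q ∈ Q) : anc q = T.anc q := by
  obtain ⟨j, -, rfl⟩ := mem_image.1 (h.subset_image hq)
  exact h.anc_eq j

include hne

theorem reanchor (i : Fin k) : Reanchorable T anc Q (reanchor anc Q α i) where
  subset_image q hq := by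
    obtain ⟨j, -, rfl⟩ := mem_image.1 (h.subset_image hq)
    exact mem_image.2 ⟨j, mem_univ j, reanchor_apply_of_mem hq⟩
  anc_eq j := by
    rcases reanchor_mem_or_eq hne i j with hj | hj
    · exact h.anc_eq_of_mem hj
    · rw [hj]; exact h.anc_eq j
  notMem_anc j hj := by
    have heq := (reanchor_mem_or_eq hne i j).resolve_left hj
    rw [heq] at hj ⊢
    exact h.notMem_anc j hj

theorem potential_reanchor_add_card_le (c : Fin k → ℕ) (i : Fin k) :
    potential T c Q (Memory.reanchor anc Q α i) + #{j | α j ∉ Q} ≤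
      potential T c Q α + #{j | Memory.reanchor anc Q α i j ∉ Q} := by
  by_cases hi : α i ∈ Q
  · rw [Memory.reanchor, if_pos hi]
  have hv := cheapest_mem (anc := anc) (α := α) (i := i) hne
  have hpot := potential_update_add_one_le (c := c) h.subset_image hi hv (fun w hw => by
    rw [← moveCost_congr (fun j _ => h.anc_eq j) (h.anc_eq i) (h.anc_eq_of_mem hv),
      ← moveCost_congr (fun j _ => h.anc_eq j) (h.anc_eq i) (h.anc_eq_of_mem hw)]
    exact moveCost_cheapest_le hw) (h.notMem_anc i hi _ hv)
  have hwait : ({j | α j ∉ Q} : Finset (Fin k)) ⊆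
      insert i ({j | Memory.reanchor anc Q α i j ∉ Q} : Finset (Fin k)) := by
    intro j hj
    by_cases hji : j = i
    · exact hji ▸ mem_insert_self _ _
    · refine mem_insert_of_mem (mem_filter.2 ⟨mem_univ j, ?_⟩)
      rw [Memory.reanchor, if_neg hi, Function.update_of_ne hji]
      exact (mem_filter.1 hj).2
  have := (card_le_card hwait).trans (card_insert_le _ _)
  rw [Memory.reanchor, if_neg hi] at this ⊢
  omega

theorem potential_foldl_reanchor_add_card_le (c : Fin k → ℕ) (l : List (Fin k)) :
    potential T c Q (l.foldl (Memory.reanchor anc Q) α) + #{j | α j ∉ Q} ≤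
      potential T c Q α + #{j | l.foldl (Memory.reanchor anc Q) α j ∉ Q} := by
  induction l generalizing α with
  | nil => exact le_rfl
  | cons i l ih =>
    have hstep := h.potential_reanchor_add_card_le hne c i
    have := ih (h.reanchor hne i)
    rw [List.foldl_cons]
    omega

theorem potential_foldl_reanchor_finRange_add_card_le (c : Fin k → ℕ) :
    potential T c Q ((List.finRange k).foldl (Memory.reanchor anc Q) α) + #{j | α j ∉ Q} ≤
      potential T c Q α := by
  have := h.potential_foldl_reanchor_add_card_le hne c (List.finRange k)
  rwa [filter_false_of_mem (p := fun j => (List.finRange k).foldl _ α j ∉ Q) fun j _ hj =>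
    hj (foldl_reanchor_apply_mem hne (List.mem_finRange j)), card_empty, Nat.cast_zero,
    add_zero] at this

end Reanchorable

end Memory

namespace Lowering

variable {V ι : Type*} [DecidableEq V] {T : ParentTree V} {H : SimpleGraph V}
  {Z : V → Prop} {W Q : Finset V} {c α α' : ι → V} {i j : ι} (hL : Lowering T Z Q c α α')

open ParentTree

include hL

theorem of_ne (h : α' i ≠ α i) : α' i ∈ T.anc (c i) ∧ α' i ≠ T.root ∧ T.parent (α' i) = α i := by
  rcases hL.lowered_or_eq i with ⟨-, -, -, hlowered⟩ | ⟨-, heq⟩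
  · exact hlowered
  · exact absurd heq h

theorem notMem_anc_of_ne (hA : Anchored T H W c α) (h : α' i ≠ α i) (hij : i ≠ j) :
    α' i ∉ T.anc (α' j) := by
  intro hmem
  obtain ⟨hi, -, -⟩ := hL.of_ne h
  by_cases hj : α' j = α j
  · have heq := hA.antichain i j (anc_subset (hj ▸ hmem) (hL.mem_anc i))
    exact h (anc_antisymm (heq ▸ hj ▸ hmem) (hL.mem_anc i))
  · exact hij (hA.eq_of_mem i j _ hi (anc_subset (hL.of_ne hj).1 hmem) (hL.mem_anc i) h)

theorem anc_inter_anc_eq (hA : Anchored T H W c α) (hij : i ≠ j) :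
    T.anc (α' i) ∩ T.anc (α' j) = T.anc (α i) ∩ T.anc (α j) := by
  have hleft : ∀ {i j}, i ≠ j → T.anc (α' i) ∩ T.anc (α' j) = T.anc (α i) ∩ T.anc (α' j) := by
    intro i j hij
    by_cases h : α' i = α i
    · rw [h]
    · obtain ⟨-, hroot, hparent⟩ := hL.of_ne h
      rw [anc_eq_insert hroot, hparent, insert_inter_of_notMem (hL.notMem_anc_of_ne hA h hij)]
  refine Subset.antisymm (subset_inter ?_ ?_)
    (inter_subset_inter (anc_subset (hL.mem_anc i)) (anc_subset (hL.mem_anc j)))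
  · exact (hleft hij).trans_subset inter_subset_left
  · rw [inter_comm]
    exact (hleft hij.symm).trans_subset inter_subset_left

variable [Fintype ι]

theorem sum_dist_add_card :
    ∑ i, T.dist (c i) (α' i) + #{i | α' i ≠ α i} = ∑ i, T.dist (c i) (α i) := by
  rw [card_filter, ← sum_add_distrib]
  refine sum_congr rfl fun i _ => ?_
  split_ifs with h
  · obtain ⟨hmem, hroot, hparent⟩ := hL.of_ne h
    rw [T.dist_comm, dist_add_one_eq_dist_parent hroot hmem, hparent, T.dist_comm]
  · rw [not_not.1 h, add_zero]

theorem sum_card_anc_eq : ∑ i, #(T.anc (α' i)) = ∑ i, #(T.anc (α i)) + #{i | α' i ≠ α i} := by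
  rw [card_filter, ← sum_add_distrib]
  refine sum_congr rfl fun i _ => ?_
  split_ifs with h
  · obtain ⟨-, hroot, hparent⟩ := hL.of_ne h
    rw [anc_eq_insert hroot, card_insert_of_notMem (notMem_anc_parent hroot), hparent]
  · rw [not_not.1 h, add_zero]

theorem card_span_le :
    #(T.span (univ.image α')) ≤ #(T.span (univ.image α)) + #{i | α' i ≠ α i} := by
  have hsub : T.span (univ.image α') ⊆
      T.span (univ.image α) ∪ ({i | α' i ≠ α i} : Finset ι).image α' := by
    intro e he
    obtain ⟨i, hi⟩ := mem_span_image.1 he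
    by_cases h : α' i = α i
    · exact mem_union_left _ (mem_span_image.2 ⟨i, h ▸ hi⟩)
    · obtain ⟨-, hroot, hparent⟩ := hL.of_ne h
      rcases (mem_anc_iff hroot).1 hi with rfl | hi
      · exact mem_union_right _ (mem_image_of_mem _ (mem_filter.2 ⟨mem_univ i, h⟩))
      · exact mem_union_left _ (mem_span_image.2 ⟨i, hparent ▸ hi⟩)
  exact (card_le_card hsub).trans ((card_union_le _ _).trans (Nat.add_le_add_left card_image_le _))

variable [DecidableEq ι]

theorem minEnergy_image_le (hne : Q.Nonempty) :
    minEnergy T.anc α (univ.image α) ≤ minEnergy T.anc α' Q := by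
  obtain ⟨β, hβ, hβE⟩ := exists_energy_eq_minEnergy (P := T.anc) α' hne
  have hrange : ∀ t, ∃ i, α' i = β t := by
    intro t
    by_cases ht : β t ∈ Q
    · exact ((hL.mem_open _).1 ht).1
    · have hpos : 0 < #{s | β s = β t} := card_pos.2 ⟨t, mem_filter.2 ⟨mem_univ t, rfl⟩⟩
      obtain ⟨i, hi⟩ := card_pos.1 (hpos.trans_le (hβ _ ht))
      exact ⟨i, (mem_filter.1 hi).2⟩
  choose g hg using hrange
  have hfeasible : Feasible univ α (univ.image α) fun t => α (g t) := by
    intro v hv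
    rw [filter_false_of_mem fun t _ (ht : α (g t) = v) =>
      hv (ht ▸ mem_image_of_mem α (mem_univ (g t)))]
    exact Nat.zero_le _
  calc minEnergy T.anc α (univ.image α) ≤ energy T.anc fun t => α (g t) :=
        minEnergy_le_energy hfeasible
    _ ≤ energy T.anc β := energy_mono fun s t => by
        rw [← hg s, ← hg t]
        exact card_le_card (inter_subset_inter (anc_subset (hL.mem_anc _))
          (anc_subset (hL.mem_anc _)))
    _ = minEnergy T.anc α' Q := hβE

theorem potential_le (hA : Anchored T H W c α) (hne : Q.Nonempty) :
    potential T c Q α' ≤ potential T c (univ.image α) α := by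
  have hdist := hL.sum_dist_add_card
  have hanc := hL.sum_card_anc_eq
  have hspan := hL.card_span_le
  have hmin := hL.minEnergy_image_le hne
  have henergy : energy T.anc α' = energy T.anc α := energy_congr fun i j hij =>
    congrArg card (hL.anc_inter_anc_eq hA hij)
  unfold potential
  simp only [← Nat.cast_sum, henergy]
  omega

end Lowering

section Moves

variable {V : Type*} [DecidableEq V] {T : ParentTree V} {H : SimpleGraph V} {W W' : Finset V}
  {p a p' : V}

open ParentTree

theorem RoundMove.dist_add_one_le (h : RoundMove T H W W' p a p') :
    T.dist p' a + 1 ≤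
      T.dist p a + 2 * (if p' ∉ W then 1 else 0) + if p = a ∧ p' = p then 1 else 0 := by
  cases h with
  | explore below new adj ne parent =>
    have hbelow : p' ∉ T.anc a := fun hmem =>
      notMem_anc_parent ne (parent.symm ▸ anc_subset below hmem)
    have := dist_parent_add_one hbelow
    rw [parent] at this
    rw [if_pos new]
    omega
  | up below ne done eq =>
    have := dist_parent_add_one (T := T) fun h => ne (anc_antisymm h below)
    rw [eq]
    omega
  | stay at_anchor done eq =>
    have hstay : p = a ∧ p' = p := ⟨at_anchor, eq⟩
    rw [if_pos hstay, eq]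
    omega
  | down not_below mem ne parent =>
    have := dist_add_one_eq_dist_parent ne mem
    rw [parent] at this
    omega
  | back not_below not_above eq =>
    have := dist_parent_add_one not_above
    rw [eq]
    omega

theorem RoundMove.mem_of_adj (h : RoundMove T H W W' p a p') (hp : p ∈ W) (hpa : p = a)
    (hpp : p' = p) {b : V} (hb : H.Adj p b) : b ∈ W' := by
  cases h with
  | explore below new adj ne parent => exact absurd (hpp ▸ hp) new
  | up below ne done eq => exact absurd hpa ne
  | stay at_anchor done eq => exact done b hb
  | down not_below mem ne parent => exact absurd (hpa ▸ self_mem_anc p) not_below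
  | back not_below not_above eq => exact absurd (hpa ▸ self_mem_anc p) not_below

end Moves

namespace Memory

variable {k : ℕ} {T : ParentTree ℕ} {nodes : Finset ℕ} {H : SimpleGraph ℕ} {m : Memory k}

section Advance

variable {c : Fin k → ℕ}

theorem anchor_advance_mem (hne : (m.openAnchors H c).Nonempty) (i : Fin k) :
    (m.advance H c).anchor i ∈ m.openAnchors H c :=
  foldl_reanchor_apply_mem hne (List.mem_finRange i)

variable (hs : (m.moved c).Sound T nodes)

include hs

theorem lowered_mem_visitedAfter (i : Fin k) : m.lowered H c i ∈ m.visitedAfter c := by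
  rcases (hs.lowering (H := H)).lowered_or_eq i with ⟨-, -, -, hmem, -⟩ | ⟨-, heq⟩
  · exact hs.anc_subset (hs.pos_mem i) hmem
  · exact heq ▸ hs.anchor_mem i

theorem sound_advance (hne : (m.openAnchors H c).Nonempty) :
    (m.advance H c).Sound T nodes where
  visited_subset := hs.visited_subset
  root_mem := hs.root_mem
  parent_mem := hs.parent_mem
  pos_mem := hs.pos_mem
  anchor_mem i := by
    obtain ⟨⟨j, hj⟩, -⟩ := (hs.lowering.mem_open _).1 (anchor_advance_mem hne i)
    exact hj ▸ lowered_mem_visitedAfter hs j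
  parent_eq := hs.parent_eq
  anc_eq := hs.anc_eq

variable (hA : Anchored T H (m.visitedAfter c) c m.anchor)

include hA

theorem openAnchors_nonempty (hne : ¬ (m.advance H c).Explored H) :
    (m.openAnchors H c).Nonempty := by
  simp only [Explored, not_forall] at hne
  obtain ⟨v, hv, a, hadj, ha⟩ := hne
  obtain ⟨i, hi, -⟩ := hs.lowering.exists_open_of_dangling hA (fun _ hq => hq.2) hv hadj ha
  exact ⟨_, hi⟩

theorem reanchorable_lowered :
    Reanchorable T (m.ancAfter c) (m.openAnchors H c) (m.lowered H c) where
  subset_image q hq := by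
    obtain ⟨⟨i, rfl⟩, -⟩ := (hs.lowering.mem_open q).1 hq
    exact mem_image_of_mem _ (mem_univ i)
  anc_eq i := hs.anc_eq _ (lowered_mem_visitedAfter hs i)
  notMem_anc i hi q hq := by
    obtain ⟨heq, hz, -⟩ := hs.lowering.of_notMem_open hA.antichain hi
    rw [heq]
    exact hs.lowering.open_notMem_anc hA.antichain (Or.inr hz) hq

variable (hne : (m.openAnchors H c).Nonempty)

include hne

theorem image_anchor_advance : univ.image (m.advance H c).anchor = m.openAnchors H c :=
  image_foldl_reanchor_finRange hne (reanchorable_lowered hs hA).subset_image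

theorem anchored_advance :
    Anchored T H (m.visitedAfter c) c (m.advance H c).anchor :=
  hs.lowering.anchored hA (fun _ hq => hq.2) (fun _ hi => foldl_reanchor_apply_of_mem _ hi)
    (anchor_advance_mem hne)

theorem potential_advance_add_card_le :
    potential T c (univ.image (m.advance H c).anchor) (m.advance H c).anchor +
        #{i | m.lowered H c i ∉ m.openAnchors H c} ≤
      potential T c (univ.image m.anchor) m.anchor := by
  rw [image_anchor_advance hs hA hne]
  exact ((reanchorable_lowered hs hA).potential_foldl_reanchor_finRange_add_card_le hne c).trans
    (hs.lowering.potential_le hA hne)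

end Advance

/-- The potential of the whole exploration: that of the robots and anchors, plus twice the number
of nodes that are not visited yet. -/
noncomputable def totalPotential (T : ParentTree ℕ) (nodes : Finset ℕ) (m : Memory k) : ℤ :=
  2 * #(nodes \ m.visited) + potential T m.pos (univ.image m.anchor) m.anchor

section Round

variable (hH : TreeGraph T nodes H) (hm : m.Sound T nodes)
  (hA : Anchored T H m.visited m.pos m.anchor) (hne : ¬ m.Explored H)

include hH hm hA hne

theorem card_new_add_card_sdiff_le :
    #{i | m.next H i ∉ m.visited} + #(nodes \ m.visitedAfter (m.next H)) ≤
      #(nodes \ m.visited) := by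
  have hs := sound_moved_next hH hm hA hne
  rw [← card_image_of_injOn (f := m.next H) (s := {i | m.next H i ∉ m.visited})
      fun i hi j _ hij => eq_of_next_eq hH hm hA hne (mem_filter.1 hi).2 hij,
    ← card_union_of_disjoint]
  · refine card_le_card (union_subset (image_subset_iff.2 fun i hi => ?_)
      (sdiff_subset_sdiff Subset.rfl subset_union_left))
    exact mem_sdiff.2 ⟨hs.visited_subset (hs.pos_mem i), (mem_filter.1 hi).2⟩
  · refine disjoint_left.2 fun v hv hv' => (mem_sdiff.1 hv').2 ?_
    obtain ⟨i, -, rfl⟩ := mem_image.1 hv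
    exact hs.pos_mem i

theorem sum_dist_next_add_le :
    2 * #(nodes \ m.visitedAfter (m.next H)) + ∑ i, T.dist (m.next H i) (m.anchor i) + k ≤
      2 * #(nodes \ m.visited) + ∑ i, T.dist (m.pos i) (m.anchor i) +
        #{i | m.pos i = m.anchor i ∧ m.next H i = m.pos i} := by
  have hnew := card_new_add_card_sdiff_le hH hm hA hne
  have hsum := sum_le_sum fun i (_ : i ∈ univ) => (roundMove hH hm hA hne i).dist_add_one_le
  rw [sum_add_distrib, sum_add_distrib, sum_add_distrib, ← mul_sum, ← card_filter, ← card_filter,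
    sum_const, card_univ, Fintype.card_fin, smul_eq_mul, mul_one] at hsum
  omega

theorem lowered_notMem_openAnchors {i : Fin k} (hpos : m.pos i = m.anchor i)
    (hnext : m.next H i = m.pos i) : m.lowered H (m.next H) i ∉ m.openAnchors H (m.next H) := by
  have hL := (sound_moved_next hH hm hA hne).lowering (H := H)
  have hclosing : m.Closing H (m.next H) (m.anchor i) :=
    ⟨⟨i, rfl, hnext.trans hpos⟩, fun a ha =>
      (roundMove hH hm hA hne i).mem_of_adj (hm.pos_mem i) hpos hnext (hpos.symm ▸ ha)⟩
  rw [hL.of_not i fun h => h.2.2 (hnext.trans hpos)]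
  exact fun h => ((hL.mem_open _).1 h).2 hclosing

variable (hne' : ¬ (m.advance H (m.next H)).Explored H)

include hne'

theorem sound_advance_next : (m.advance H (m.next H)).Sound T nodes :=
  have hs := sound_moved_next hH hm hA hne
  have hA' := anchored_next hH hm hA hne
  sound_advance hs (openAnchors_nonempty hs hA' hne')

theorem anchored_advance_next : Anchored T H (m.advance H (m.next H)).visited
    (m.advance H (m.next H)).pos (m.advance H (m.next H)).anchor :=
  have hs := sound_moved_next hH hm hA hne
  have hA' := anchored_next hH hm hA hne
  anchored_advance hs hA' (openAnchors_nonempty hs hA' hne')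

/-- A robot that stays at its anchor does not contribute to the decrease of the potential by its
move, but it gets a new anchor, which does. -/
theorem totalPotential_advance_next_add_le :
    totalPotential T nodes (m.advance H (m.next H)) + k ≤ totalPotential T nodes m := by
  have hs := sound_moved_next hH hm hA hne
  have hA' := anchored_next hH hm hA hne
  have hanchors := potential_advance_add_card_le hs hA' (openAnchors_nonempty hs hA' hne')
  have hmoves := sum_dist_next_add_le hH hm hA hne
  have hwait : #{i | m.pos i = m.anchor i ∧ m.next H i = m.pos i} ≤
      #{i | m.lowered H (m.next H) i ∉ m.openAnchors H (m.next H)} :=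
    card_le_card (monotone_filter_right _ fun i _ hi =>
      lowered_notMem_openAnchors hH hm hA hne hi.1 hi.2)
  have hpos : potential T (m.next H) (univ.image m.anchor) m.anchor =
      potential T m.pos (univ.image m.anchor) m.anchor +
      (∑ i, (T.dist (m.next H i) (m.anchor i) : ℤ) - ∑ i, (T.dist (m.pos i) (m.anchor i) : ℤ)) := by
    unfold potential; ring
  have hadvance : totalPotential T nodes (m.advance H (m.next H)) =
      2 * #(nodes \ m.visitedAfter (m.next H)) + potential T (m.next H)
        (univ.image (m.advance H (m.next H)).anchor) (m.advance H (m.next H)).anchor := rfl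
  rw [hadvance, totalPotential]
  simp only [← Nat.cast_sum] at hpos
  omega

end Round

end Memory

theorem ParentTree.iterate_parent_eq_root_of_depth_le {V : Type*} {T : ParentTree V} {v : V} {D : ℕ}
    (h : T.depth v ≤ D) : T.parent^[D] v = T.root := by
  induction D generalizing v with
  | zero =>
    by_contra hv
    have := T.depth_of_ne_root v hv
    omega
  | succ D ih =>
    rw [Function.iterate_succ_apply]
    refine ih ?_
    by_cases hv : v = T.root
    · rw [hv, T.parent_root, T.depth_root]
      exact Nat.zero_le _
    · have := T.depth_of_ne_root v hv
      omega

namespace Memory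

open ParentTree

variable {k : ℕ} {T : ParentTree ℕ} {nodes : Finset ℕ} {H : SimpleGraph ℕ} {m : Memory k}
  {c : Fin k → ℕ} {t D : ℕ}

section Start

variable (T) in
theorem mem_visited_start (hk : 1 ≤ k) {v : ℕ} :
    v ∈ (start fun _ : Fin k => T.root).visited ↔ v = T.root := by
  have : Nonempty (Fin k) := ⟨⟨0, hk⟩⟩
  simp [start, eq_comm]

theorem sound_start (hk : 1 ≤ k) (hH : TreeGraph T nodes H) :
    (start fun _ : Fin k => T.root).Sound T nodes := by
  have hroot {v : ℕ} := mem_visited_start T hk (v := v)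
  refine ⟨fun v hv => ?_, hroot.2 rfl, fun v hv => ?_, fun _ => hroot.2 rfl, fun _ => hroot.2 rfl,
    fun v hv => ?_, fun v hv => ?_⟩ <;> rw [hroot.1 hv]
  · exact hH.root_mem
  · exact hroot.2 T.parent_root
  · exact T.parent_root.symm
  · exact anc_root.symm

theorem anchored_start :
    Anchored T H (start fun _ : Fin k => T.root).visited (start fun _ : Fin k => T.root).pos
      (start fun _ : Fin k => T.root).anchor where
  antichain _ _ _ := rfl
  below_or_outside _ := Or.inl (self_mem_anc _)
  eq_of_mem _ _ _ hx _ _ hne := absurd (mem_anc_root.1 hx) hne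
  dangling v hv _ _ _ := by
    obtain ⟨i, -, hi⟩ := mem_image.1 hv
    exact Or.inl ⟨i, hi⟩

theorem totalPotential_start_le (k : ℕ) (T : ParentTree ℕ) (nodes : Finset ℕ) :
    totalPotential T nodes (start fun _ : Fin k => T.root) ≤ 2 * #nodes + 3 + 6 * (k * k : ℕ) := by
  have hnew : #(nodes \ (start fun _ : Fin k => T.root).visited) ≤ #nodes :=
    card_le_card sdiff_subset
  have hspan : #(T.span (univ.image fun _ : Fin k => T.root)) ≤ 1 := by
    refine (card_le_card fun v hv => ?_).trans (card_singleton T.root).le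
    obtain ⟨-, hi⟩ := mem_span_image.1 hv
    exact mem_singleton.2 (mem_anc_root.1 hi)
  have henergy : energy T.anc (fun _ : Fin k => T.root) ≤ k * k := by
    have := energy_le (P := T.anc) (f := fun _ : Fin k => T.root) (b := 1) fun _ => by
      rw [card_anc, T.depth_root]
    simpa using this
  have hanc : 0 ≤ ∑ _i : Fin k, (#(T.anc T.root) : ℤ) := sum_nonneg fun _ _ => Int.natCast_nonneg _
  have hdist : ∑ _i : Fin k, (T.dist T.root T.root : ℤ) = 0 := by simp [ParentTree.dist_self]
  simp only [totalPotential, potential, start] at hnew ⊢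
  omega

end Start

theorem Sound.neg_le_totalPotential (hk : 1 ≤ k) (hm : m.Sound T nodes)
    (hD : ∀ v ∈ nodes, T.depth v ≤ D) :
    -(2 * (k * (D + 1)) + 27 * (k * (k * (D + 1))) : ℤ) ≤ totalPotential T nodes m := by
  have hanchor (i : Fin k) : #(T.anc (m.anchor i)) ≤ D + 1 := by
    rw [card_anc]
    exact Nat.succ_le_succ (hD _ (hm.visited_subset (hm.anchor_mem i)))
  have hanc : ∑ i, (#(T.anc (m.anchor i)) : ℤ) ≤ k * (D + 1) :=
    calc ∑ i, (#(T.anc (m.anchor i)) : ℤ) ≤ ∑ _i : Fin k, ((D : ℤ) + 1) :=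
          sum_le_sum fun i _ => mod_cast hanchor i
      _ = k * (D + 1) := by simp
  have hmin : minEnergy T.anc m.anchor (univ.image m.anchor) ≤ 9 * (k * (k * (D + 1))) :=
    calc minEnergy T.anc m.anchor (univ.image m.anchor)
        ≤ energy T.anc fun _ : Fin 3 × Fin k => m.anchor ⟨0, hk⟩ :=
          minEnergy_le_energy (feasible_const (mem_image_of_mem _ (mem_univ _)))
      _ ≤ Fintype.card (Fin 3 × Fin k) * (Fintype.card (Fin 3 × Fin k) * (D + 1)) :=
          energy_le fun _ => hanchor _
      _ = 9 * (k * (k * (D + 1))) := by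
          rw [Fintype.card_prod, Fintype.card_fin, Fintype.card_fin]
          ring
  have hdist : 0 ≤ ∑ i, (T.dist (m.pos i) (m.anchor i) : ℤ) :=
    sum_nonneg fun _ _ => Int.natCast_nonneg _
  zify at hmin
  rw [totalPotential, potential]
  linarith

/-- The exploration is finished: all nodes have been visited and their parents are known. -/
structure Complete (T : ParentTree ℕ) (nodes : Finset ℕ) (m : Memory k) : Prop where
  visited_eq : m.visited = nodes
  pos_mem : ∀ i, m.pos i ∈ nodes
  parent_eq : ∀ v ∈ nodes, m.parent v = T.parent v

section Complete

variable (hH : TreeGraph T nodes H)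

include hH

theorem Sound.visited_eq (hm : m.Sound T nodes) (hE : m.Explored H) : m.visited = nodes := by
  refine Subset.antisymm hm.visited_subset fun v hv => ?_
  induction v using T.parent_induction with
  | root => exact hm.root_mem
  | step v hr ih => exact hE _ (ih (hH.parent_mem v hv)) v (hH.adj_parent hv hr).symm

theorem Sound.complete (hm : m.Sound T nodes) (hE : m.Explored H) : m.Complete T nodes where
  visited_eq := hm.visited_eq hH hE
  pos_mem i := hm.visited_subset (hm.pos_mem i)
  parent_eq v hv := hm.parent_eq v (hm.visited_eq hH hE ▸ hv)

namespace Complete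

theorem next_eq (hm : m.Complete T nodes) (i : Fin k) : m.next H i = T.parent (m.pos i) := by
  have hE : m.Explored H := fun v _ a h => hm.visited_eq ▸ ((hH.adj_iff _ _).1 h).2.1
  simp only [next, instruction, if_pos hE, hm.parent_eq _ (hm.pos_mem i)]
  by_cases hr : m.pos i = T.root
  · rw [hr, T.parent_root, ite_self]
  · rw [if_pos (hH.adj_parent (hm.pos_mem i) hr)]

theorem advance_next (hm : m.Complete T nodes) : (m.advance H (m.next H)).Complete T nodes := by
  have hnext (i : Fin k) : m.next H i ∈ nodes := by
    rw [hm.next_eq hH]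
    exact hH.parent_mem _ (hm.pos_mem i)
  refine ⟨?_, hnext, fun v hv => ?_⟩
  · change m.visited ∪ univ.image (m.next H) = nodes
    rw [hm.visited_eq, union_eq_left]
    exact image_subset_iff.2 fun i _ => hnext i
  · exact (if_pos (hm.visited_eq ▸ hv)).trans (hm.parent_eq v hv)

theorem process_add (hm : (process H c t).Complete T nodes) (s : ℕ) :
    (process H c (t + s)).Complete T nodes := by
  induction s with
  | zero => exact hm
  | succ s ih =>
    rw [← add_assoc, process_succ]
    exact ih.advance_next hH

theorem pos_process_add (hm : (process H c t).Complete T nodes) (s : ℕ) (i : Fin k) :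
    (process H c (t + s)).pos i = T.parent^[s] ((process H c t).pos i) := by
  induction s with
  | zero => rfl
  | succ s ih =>
    rw [← add_assoc, process_succ, Function.iterate_succ_apply', ← ih]
    exact (hm.process_add hH s).next_eq hH i

end Complete

end Complete

/-- Some robot has entered `v` from its parent within the first `t` rounds. -/
def Entered (T : ParentTree ℕ) (H : SimpleGraph ℕ) (c : Fin k → ℕ) (t v : ℕ) : Prop :=
  ∃ s < t, ∃ i, (process H c s).pos i = T.parent v ∧ (process H c (s + 1)).pos i = v

theorem Entered.mono {v s : ℕ} (h : Entered T H c t v) (hts : t ≤ s) : Entered T H c s v := by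
  obtain ⟨u, hu, h⟩ := h
  exact ⟨u, hu.trans_le hts, h⟩

/-- The invariants of an exploration in which there are still dangling edges at time `t`: the
potential pays for every round with one unit per robot. -/
structure Exploring (T : ParentTree ℕ) (nodes : Finset ℕ) (H : SimpleGraph ℕ) (c : Fin k → ℕ)
    (t : ℕ) : Prop where
  not_explored : ¬ (process H c t).Explored H
  sound : (process H c t).Sound T nodes
  anchored : Anchored T H (process H c t).visited (process H c t).pos (process H c t).anchor
  entered : ∀ v ∈ (process H c t).visited, v ≠ T.root → Entered T H c t v
  totalPotential_add_le :
    totalPotential T nodes (process H c t) + k * t ≤ totalPotential T nodes (start c)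

namespace Exploring

section Round

variable (hH : TreeGraph T nodes H) (h : Exploring T nodes H c t)

include hH h

theorem entered_succ {v : ℕ} (hv : v ∈ (process H c (t + 1)).visited) (hr : v ≠ T.root) :
    Entered T H c (t + 1) v := by
  by_cases hold : v ∈ (process H c t).visited
  · exact (h.entered v hold hr).mono t.le_succ
  · rw [process_succ] at hv
    obtain ⟨i, rfl⟩ := exists_of_mem_visitedAfter hv hold
    obtain ⟨-, -, -, hparent⟩ := of_next_notMem_visited hH h.sound h.anchored h.not_explored hold
    exact ⟨t, t.lt_succ_self, i, hparent.symm, by rw [process_succ]; rfl⟩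

theorem succ (hne : ¬ (process H c (t + 1)).Explored H) : Exploring T nodes H c (t + 1) := by
  have hentered := fun v hv => h.entered_succ hH (v := v) hv
  obtain ⟨hne', hm, hA, -, hpot⟩ := h
  refine ⟨hne, ?_, ?_, hentered, ?_⟩ <;> rw [process_succ] at hne ⊢
  · exact sound_advance_next hH hm hA hne' hne
  · exact anchored_advance_next hH hm hA hne' hne
  · have := totalPotential_advance_next_add_le hH hm hA hne' hne
    push_cast
    linarith

theorem complete_succ (hE : (process H c (t + 1)).Explored H) :
    (process H c (t + 1)).Complete T nodes := by
  rw [process_succ] at hE ⊢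
  obtain ⟨hvisited, hpos, hparent⟩ :=
    (sound_moved_next hH h.sound h.anchored h.not_explored).complete hH hE
  exact ⟨hvisited, hpos, hparent⟩

end Round

variable (hk : 1 ≤ k)

include hk

theorem of_not_explored (hH : TreeGraph T nodes H)
    (hne : ∀ s ≤ t, ¬ (process H (fun _ : Fin k => T.root) s).Explored H) :
    Exploring T nodes H (fun _ : Fin k => T.root) t := by
  induction t with
  | zero =>
    refine ⟨hne 0 le_rfl, sound_start hk hH, anchored_start, fun v hv hr => ?_, ?_⟩
    · exact absurd ((mem_visited_start T hk).1 hv) hr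
    · simp [process]
  | succ t ih => exact (ih fun s hs => hne s (hs.trans t.le_succ)).succ hH (hne _ le_rfl)

theorem mul_le (h : Exploring T nodes H (fun _ : Fin k => T.root) t)
    (hD : ∀ v ∈ nodes, T.depth v ≤ D) :
    k * t ≤ 2 * #nodes + 3 + 6 * (k * k) + 2 * (k * (D + 1)) + 27 * (k * (k * (D + 1))) := by
  have hfinal := h.sound.neg_le_totalPotential hk hD
  have hstart := totalPotential_start_le k T nodes
  have := h.totalPotential_add_le
  zify at hstart ⊢
  linarith

end Exploring

section Return

variable (hk : 1 ≤ k) (hH : TreeGraph T nodes H) (hD : ∀ v ∈ nodes, T.depth v ≤ D)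

include hk hH hD

theorem exists_explored : ∃ t, (process H (fun _ : Fin k => T.root) t).Explored H := by
  by_contra! hne
  have hbound (t : ℕ) := (Exploring.of_not_explored hk hH (t := t) fun s _ => hne s).mul_le hk hD
  exact absurd ((Nat.le_mul_of_pos_left _ hk).trans (hbound (_ + 1))) (Nat.not_succ_le_self _)

theorem exists_complete :
    ∃ t, (process H (fun _ : Fin k => T.root) t).Complete T nodes ∧
      (∀ v ∈ nodes, v ≠ T.root → Entered T H (fun _ : Fin k => T.root) t v) ∧
      k * t ≤ 2 * #nodes + 3 + 6 * (k * k) + 2 * (k * (D + 1)) + 27 * (k * (k * (D + 1))) + k := by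
  classical
  have hex := exists_explored hk hH hD
  obtain ⟨t, ht, hmin⟩ : ∃ t, (process H (fun _ : Fin k => T.root) t).Explored H ∧
      ∀ s < t, ¬ (process H (fun _ : Fin k => T.root) s).Explored H :=
    ⟨Nat.find hex, Nat.find_spec hex, fun _ => Nat.find_min hex⟩
  refine ⟨t, ?_⟩
  cases t with
  | zero =>
    have hc := (sound_start hk hH).complete hH ht
    refine ⟨hc, fun v hv hr => ?_, by omega⟩
    rw [← hc.visited_eq] at hv
    exact absurd ((mem_visited_start T hk).1 hv) hr
  | succ t =>
    have h := Exploring.of_not_explored hk hH fun s hs => hmin s (Nat.lt_succ_of_le hs)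
    have hc := h.complete_succ hH ht
    have := h.mul_le hk hD
    refine ⟨hc, fun v hv => h.entered_succ hH (hc.visited_eq.symm ▸ hv), ?_⟩
    rw [mul_add_one]
    omega

theorem exists_return (hD' : 1 ≤ D) :
    ∃ t, (∀ i, (process H (fun _ : Fin k => T.root) t).pos i = T.root) ∧
      (∀ v ∈ nodes, v ≠ T.root → Entered T H (fun _ : Fin k => T.root) t v) ∧
      k * t ≤ 2 * #nodes + 69 * (k * k * D) := by
  obtain ⟨t, hc, hentered, hle⟩ := exists_complete hk hH hD
  refine ⟨t + D, fun i => ?_, fun v hv hr => (hentered v hv hr).mono (Nat.le_add_right t D), ?_⟩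
  · rw [hc.pos_process_add hH, iterate_parent_eq_root_of_depth_le (hD _ (hc.pos_mem i))]
  · have hkk : k * 1 ≤ k * k := Nat.mul_le_mul_left k hk
    have hkD : k * D ≤ k * k * D := Nat.mul_le_mul_right D (by omega)
    have hkkD : k * k * 1 ≤ k * k * D := Nat.mul_le_mul_left _ hD'
    nlinarith

end Return

end Memory

namespace ParentTree

variable {V W : Type*}

/-- The image of a rooted tree under an embedding; the elements outside the range are added as
children of the root. -/
noncomputable def map (T : ParentTree V) (f : V ↪ W) : ParentTree W where
  root := f T.root
  parent := Function.extend f (fun v => f (T.parent v)) fun _ => f T.root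
  depth := Function.extend f T.depth fun _ => 1
  parent_root := by rw [f.injective.extend_apply, T.parent_root]
  depth_root := by rw [f.injective.extend_apply, T.depth_root]
  depth_of_ne_root w hw := by
    by_cases h : ∃ v, f v = w
    · obtain ⟨v, rfl⟩ := h
      simp only [f.injective.extend_apply]
      exact T.depth_of_ne_root v (ne_of_apply_ne f hw)
    · rw [Function.extend_apply' _ _ _ h, Function.extend_apply' _ _ _ h, f.injective.extend_apply,
        T.depth_root]

variable {T : ParentTree V} (f : V ↪ W)

theorem parent_map (v : V) : (T.map f).parent (f v) = f (T.parent v) :=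
  f.injective.extend_apply (fun v => f (T.parent v)) (fun _ => f T.root) v

theorem depth_map (v : V) : (T.map f).depth (f v) = T.depth v :=
  f.injective.extend_apply T.depth (fun _ => 1) v

end ParentTree

theorem TreeGraph.map {V W : Type*} {T : ParentTree V} {nodes : Finset V}
    {G : SimpleGraph V} (f : V ↪ W) (hG : TreeGraph T nodes G) :
    TreeGraph (T.map f) (nodes.map f) (G.map f) where
  root_mem := mem_map_of_mem f hG.root_mem
  parent_mem w hw := by
    obtain ⟨v, hv, rfl⟩ := mem_map.1 hw
    rw [ParentTree.parent_map]
    exact mem_map_of_mem f (hG.parent_mem v hv)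
  adj_iff w w' := by
    have hne (v : V) : f v ≠ (T.map f).root ↔ v ≠ T.root := f.injective.ne_iff
    constructor
    · rw [SimpleGraph.map_adj]
      rintro ⟨u, v, h, rfl, rfl⟩
      obtain ⟨hu, hv, h⟩ := (hG.adj_iff u v).1 h
      refine ⟨mem_map_of_mem f hu, mem_map_of_mem f hv, ?_⟩
      simpa only [hne, ParentTree.parent_map, f.apply_eq_iff_eq] using h
    · rintro ⟨hw, hw', h⟩
      obtain ⟨u, hu, rfl⟩ := mem_map.1 hw
      obtain ⟨v, hv, rfl⟩ := mem_map.1 hw'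
      simp only [hne, ParentTree.parent_map, f.apply_eq_iff_eq] at h
      exact SimpleGraph.map_adj_apply.2 ((hG.adj_iff u v).2 ⟨hu, hv, h⟩)

section Rooted

variable {V : Type*} {G : SimpleGraph V} (hG : G.IsTree) (r : V)

include hG

theorem existsUnique_parent {x : V} (hx : x ≠ r) :
    ∃! y, G.Adj y x ∧ G.dist r x = G.dist r y + 1 := by
  obtain ⟨p, hp⟩ := hG.connected.exists_walk_length_eq_dist r x
  have hnil : ¬ p.Nil := SimpleGraph.Walk.not_nil_of_ne hx.symm
  refine ⟨p.penultimate, ⟨p.adj_penultimate hnil, ?_⟩, ?_⟩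
  · refine (hG.dist_eq_dist_add_one_of_adj r (p.adj_penultimate hnil)).resolve_left fun h => ?_
    have hdrop := SimpleGraph.dist_le p.dropLast
    have hlength := p.length_dropLast_add_one hnil
    omega
  · rintro y ⟨hy, hd⟩
    obtain ⟨q, hq⟩ := hG.connected.exists_walk_length_eq_dist r y
    have hpath : (q.concat hy).IsPath := by
      apply SimpleGraph.Walk.isPath_of_length_eq_dist
      rw [SimpleGraph.Walk.length_concat, hq, hd]
    rw [← (hG.existsUnique_path r x).unique hpath (p.isPath_of_length_eq_dist hp),
      SimpleGraph.Walk.penultimate_concat]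

open Classical in
/-- The tree `G` rooted at `r`; the parent of a node is its neighbour that is closer to `r`. -/
noncomputable def rootedTree : ParentTree V where
  root := r
  parent x := if hx : x = r then r else (existsUnique_parent hG r hx).choose
  depth := G.dist r
  parent_root := dif_pos rfl
  depth_root := G.dist_self
  depth_of_ne_root x hx := by
    rw [dif_neg hx]
    exact (existsUnique_parent hG r hx).choose_spec.1.2

theorem parent_rootedTree_eq_iff {x y : V} (hx : x ≠ r) :
    (rootedTree hG r).parent x = y ↔ G.Adj y x ∧ G.dist r x = G.dist r y + 1 := by
  have hspec := (existsUnique_parent hG r hx).choose_spec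
  have hparent : (rootedTree hG r).parent x = (existsUnique_parent hG r hx).choose := dif_neg hx
  rw [hparent]
  exact ⟨fun h => h ▸ hspec.1, fun h => (hspec.2 y h).symm⟩

theorem treeGraph_rootedTree [Fintype V] : TreeGraph (rootedTree hG r) univ G where
  root_mem := mem_univ _
  parent_mem _ _ := mem_univ _
  adj_iff u v := by
    have hroot {x y : V} (h : G.dist r x = G.dist r y + 1) : x ≠ r := by
      rintro rfl
      rw [G.dist_self] at h
      omega
    simp only [mem_univ, true_and]
    constructor
    · intro h
      refine (hG.dist_eq_dist_add_one_of_adj r h).symm.imp (fun hd => ?_) fun hd => ?_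
      · exact ⟨hroot hd, (parent_rootedTree_eq_iff hG r (hroot hd)).2 ⟨h, hd⟩⟩
      · exact ⟨hroot hd, (parent_rootedTree_eq_iff hG r (hroot hd)).2 ⟨h.symm, hd⟩⟩
    · rintro (⟨hv, h⟩ | ⟨hu, h⟩)
      · exact ((parent_rootedTree_eq_iff hG r hv).1 h).1
      · exact ((parent_rootedTree_eq_iff hG r hu).1 h).1.symm

end Rooted

section Run

variable {k : ℕ} {V : Type*} {G : SimpleGraph V} {r : V} {name : V ↪ ℕ} {A : Algorithm k}
  {S : State k V}

theorem run_succ (t : ℕ) : run G r name A (t + 1) = (run G r name A t).step G name A :=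
  Function.iterate_succ_apply' _ _ _

theorem State.pos_mem_visited (S : State k V) (i : Fin k) : S.pos i ∈ S.visited :=
  ⟨_, List.mem_cons_self, i, rfl⟩

theorem State.visited_step :
    (S.step G name A).visited = S.visited ∪ Set.range (S.step G name A).pos := by
  ext x
  constructor
  · rintro ⟨c, hc, i, rfl⟩
    obtain rfl | hc := List.mem_cons.1 hc
    · exact Or.inr ⟨i, rfl⟩
    · exact Or.inl ⟨c, hc, i, rfl⟩
  · rintro (⟨c, hc, i, rfl⟩ | ⟨i, rfl⟩)
    · exact ⟨c, List.mem_cons_of_mem _ hc, i, rfl⟩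
    · exact State.pos_mem_visited _ i

theorem root_mem_visited_run (hk : 1 ≤ k) (t : ℕ) : r ∈ (run G r name A t).visited := by
  induction t with
  | zero => exact State.pos_mem_visited _ ⟨0, hk⟩
  | succ t ih =>
    rw [run_succ, State.visited_step]
    exact Or.inl ih

theorem State.knowledge_map_adj {x : V} (hx : x ∈ S.visited) (a : ℕ) :
    (S.knowledge G name).map.Adj (name x) a ↔ (G.map name).Adj (name x) a := by
  simp only [State.knowledge, SimpleGraph.map_adj]
  constructor
  · rintro ⟨y, z, h, hy, hz⟩
    exact ⟨y, z, h.1, hy, hz⟩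
  · rintro ⟨y, z, h, hy, hz⟩
    obtain rfl := name.injective hy
    exact ⟨y, z, ⟨h, Or.inl hx⟩, rfl, hz⟩

open Classical in
theorem name_move (u : V) (o : Option ℕ) : name (move G name u o) =
    match o with
    | none => name u
    | some a => if (G.map name).Adj (name u) a then a else name u := by
  cases o with
  | none => rfl
  | some a =>
    have hiff : (G.map name).Adj (name u) a ↔ ∃ v, G.Adj u v ∧ name v = a := by
      rw [SimpleGraph.map_adj]
      constructor
      · rintro ⟨u', v, h, hu, hv⟩
        exact ⟨v, name.injective hu ▸ h, hv⟩
      · rintro ⟨v, h, rfl⟩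
        exact ⟨u, v, h, rfl, rfl⟩
    simp only [move, hiff]
    split_ifs with h
    · exact h.choose_spec.2
    · rfl

theorem Terminated.runtime_le {t : ℕ} (ht : Terminated G r name A t) {x : ℝ} (hx : t ≤ x) :
    (runtime G r name A : ENNReal) ≤ ENNReal.ofReal x := by
  refine (ENat.toENNReal_le.2 (iInf₂_le t ht)).trans ?_
  rw [ENat.toENNReal_coe, ← ENNReal.ofReal_natCast]
  exact ENNReal.ofReal_le_ofReal hx

end Run

/-- The memory `m` belongs to the state `S`, and it is what the team reconstructs from the history
of positions by means of any graph that is correct at the visited nodes. -/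
structure Memory.Tracks {k : ℕ} {V : Type*} (m : Memory k) (G : SimpleGraph V) (name : V ↪ ℕ)
    (S : State k V) : Prop where
  pos_eq : ∀ i, m.pos i = name (S.pos i)
  visited_eq : (m.visited : Set ℕ) = name '' S.visited
  ofHistory_eq : ∀ H : SimpleGraph ℕ,
    (∀ x ∈ S.visited, ∀ a, H.Adj (name x) a ↔ (G.map name).Adj (name x) a) →
      Memory.ofHistory H (S.knowledge G name).history = m

section Simulation

variable {k : ℕ} {V : Type*} {G : SimpleGraph V} {r : V} {name : V ↪ ℕ}

namespace Memory.Tracks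

variable {m : Memory k} {S : State k V}

theorem start : (Memory.start fun _ : Fin k => name r).Tracks G name ⟨fun _ => r, []⟩ where
  pos_eq _ := rfl
  visited_eq := by
    ext v
    simp [Memory.start, State.visited]
  ofHistory_eq _ _ := rfl

variable (h : m.Tracks G name S)

include h

theorem explorer_eq : explorer k (S.knowledge G name) = m.instruction (G.map name) := by
  rw [explorer, h.ofHistory_eq _ fun x hx => State.knowledge_map_adj hx]
  refine m.instruction_congr (fun i => ?_) fun v hv => ?_
  · rw [← mem_coe, h.visited_eq, h.pos_eq]
    exact Set.mem_image_of_mem _ (S.pos_mem_visited i)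
  · rw [← mem_coe, h.visited_eq] at hv
    obtain ⟨x, hx, rfl⟩ := hv
    exact State.knowledge_map_adj hx

theorem next_eq (i : Fin k) :
    m.next (G.map name) i = name ((S.step G name (explorer k)).pos i) := by
  have hpos : (S.step G name (explorer k)).pos i =
      move G name (S.pos i) (m.instruction (G.map name) i) := by rw [← h.explorer_eq]; rfl
  rw [hpos, name_move, Memory.next, h.pos_eq]
  cases m.instruction (G.map name) i with
  | none => rfl
  | some a => dsimp only; congr

theorem step :
    (m.advance (G.map name) (m.next (G.map name))).Tracks G name
      (S.step G name (explorer k)) where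
  pos_eq := h.next_eq
  visited_eq := by
    change ((m.visited ∪ univ.image (m.next (G.map name)) : Finset ℕ) : Set ℕ) = _
    rw [State.visited_step, Set.image_union, coe_union, h.visited_eq, coe_image, coe_univ,
      Set.image_univ, ← Set.range_comp, funext h.next_eq]
    rfl
  ofHistory_eq H hH := by
    simp only [State.visited_step] at hH
    have hhistory : Memory.ofHistory H ((S.step G name (explorer k)).knowledge G name).history =
        (Memory.ofHistory H (S.knowledge G name).history).advance H
          fun i => name ((S.step G name (explorer k)).pos i) := rfl
    rw [hhistory, h.ofHistory_eq H fun x hx => hH x (Or.inl hx), funext h.next_eq]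
    exact m.advance_congr fun i => hH _ (Or.inr ⟨i, rfl⟩)

end Memory.Tracks

theorem process_tracks_run (t : ℕ) :
    (Memory.process (G.map name) (fun _ : Fin k => name r) t).Tracks G name
      (run G r name (explorer k) t) := by
  induction t with
  | zero => exact .start
  | succ t ih =>
    rw [Memory.process_succ, run_succ]
    exact ih.step

theorem name_pos_run_explorer (t : ℕ) (i : Fin k) : name ((run G r name (explorer k) t).pos i) =
    (Memory.process (G.map name) (fun _ => name r) t).pos i :=
  ((process_tracks_run t).pos_eq i).symm

theorem terminated_explorer {T : ParentTree ℕ} {nodes : Finset ℕ} {t : ℕ}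
    (hH : TreeGraph T nodes (G.map name))
    (hpos : ∀ i, (Memory.process (G.map name) (fun _ : Fin k => name r) t).pos i = name r)
    (hentered : ∀ v ∈ nodes, v ≠ T.root →
      Memory.Entered T (G.map name) (fun _ : Fin k => name r) t v) :
    Terminated G r name (explorer k) t := by
  refine ⟨fun u v huv => ?_, fun i => name.injective ?_⟩
  · have enter {x y : V} (hy : name y ∈ nodes) (hr : name y ≠ T.root)
        (hx : T.parent (name y) = name x) : ∃ s < t, ∃ i,
        (run G r name (explorer k) s).pos i = x ∧
          (run G r name (explorer k) (s + 1)).pos i = y := by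
      obtain ⟨s, hs, i, hxi, hyi⟩ := hentered _ hy hr
      rw [← name_pos_run_explorer] at hxi hyi
      exact ⟨s, hs, i, name.injective (hxi.trans hx), name.injective hyi⟩
    obtain ⟨hu, hv, ⟨hr, h⟩ | ⟨hr, h⟩⟩ :=
      (hH.adj_iff _ _).1 (SimpleGraph.map_adj_apply.2 huv)
    · obtain ⟨s, hs, i, hi⟩ := enter hv hr h
      exact ⟨s, hs, i, Or.inl hi⟩
    · obtain ⟨s, hs, i, hi⟩ := enter hu hr h
      exact ⟨s, hs, i, Or.inr hi⟩
  · rw [name_pos_run_explorer, hpos]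

theorem dist_le_depth [Fintype V] (G : SimpleGraph V) (r x : V) : G.dist r x ≤ depth G r :=
  le_sup (f := fun v => G.dist r v) (mem_univ x)

theorem terminated_zero_of_depth_eq_zero [Fintype V] {A : Algorithm k} (hG : G.IsTree)
    (hD : depth G r = 0) : Terminated G r name A 0 := by
  have hr (x : V) : r = x :=
    hG.connected.dist_eq_zero_iff.1 (Nat.le_zero.1 (hD ▸ dist_le_depth G r x))
  exact ⟨fun u v h => absurd ((hr u).symm.trans (hr v)) h.ne, fun _ => rfl⟩

theorem exists_terminated_explorer [Fintype V] (hk : 1 ≤ k) (hG : G.IsTree) (r : V)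
    (name : V ↪ ℕ) : ∃ t, Terminated G r name (explorer k) t ∧
      k * t ≤ 2 * Fintype.card V + 69 * (k * k * depth G r) := by
  obtain hD | hD := Nat.eq_zero_or_pos (depth G r)
  · exact ⟨0, terminated_zero_of_depth_eq_zero hG hD, by simp⟩
  · have hH := (treeGraph_rootedTree hG r).map name
    have hdepth : ∀ v ∈ univ.map name, ((rootedTree hG r).map name).depth v ≤ depth G r := by
      intro v hv
      obtain ⟨x, -, rfl⟩ := mem_map.1 hv
      rw [ParentTree.depth_map]
      exact dist_le_depth G r x
    obtain ⟨t, hpos, hentered, hle⟩ := Memory.exists_return hk hH hdepth hD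
    rw [card_map, card_univ] at hle
    exact ⟨t, terminated_explorer hH hpos hentered, hle⟩

end Simulation

section Idle

variable {k l : ℕ} {V : Type*} {G : SimpleGraph V} {r : V} {name : V ↪ ℕ} {A : Algorithm l}
  {S : State k V}

/-- The present and past positions of the first `l` robots. -/
def State.restrict (h : l ≤ k) (S : State k V) : State l V where
  pos i := S.pos (Fin.castLE h i)
  past := S.past.map fun c i => c (Fin.castLE h i)

/-- All robots but the first `l` have been at `r` all the time. -/
def State.IdleAt (l : ℕ) (r : V) (S : State k V) : Prop :=
  ∀ c ∈ S.pos :: S.past, ∀ i : Fin k, l ≤ i → c i = r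

theorem State.IdleAt.visited_restrict (hS : S.IdleAt l r) (h : l ≤ k)
    (hr : r ∈ (S.restrict h).visited) : (S.restrict h).visited = S.visited := by
  have hhistory : (S.restrict h).pos :: (S.restrict h).past =
      (S.pos :: S.past).map fun c i => c (Fin.castLE h i) := rfl
  ext x
  constructor
  · rintro ⟨c, hc, i, rfl⟩
    rw [hhistory] at hc
    obtain ⟨d, hd, rfl⟩ := List.mem_map.1 hc
    exact ⟨d, hd, _, rfl⟩
  · rintro ⟨c, hc, i, rfl⟩
    obtain hi | hi := lt_or_ge i.val l
    · exact ⟨fun j => c (Fin.castLE h j), hhistory ▸ List.mem_map_of_mem hc, ⟨i, hi⟩, rfl⟩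
    · rwa [hS c hc i hi]

theorem State.knowledge_restrict (h : l ≤ k) (hS : (S.restrict h).visited = S.visited) :
    (S.restrict h).knowledge G name = (S.knowledge G name).restrict h := by
  have hdiscovered : (S.restrict h).discovered G = S.discovered G := by
    ext u v
    simp only [State.discovered, hS]
  simp only [State.knowledge, Knowledge.restrict, hdiscovered]
  simp only [State.restrict, List.map_cons, List.map_map, Function.comp_def]

theorem State.restrict_step_withIdle (h : l ≤ k) (hS : (S.restrict h).visited = S.visited) :
    (S.step G name (A.withIdle h)).restrict h = (S.restrict h).step G name A := by
  simp only [State.step, State.knowledge_restrict h hS]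
  simp [State.restrict, Algorithm.withIdle]

theorem State.IdleAt.step_withIdle (hS : S.IdleAt l r) (h : l ≤ k) :
    (S.step G name (A.withIdle h)).IdleAt l r := by
  intro c hc i hi
  obtain rfl | hc := List.mem_cons.1 hc
  · have hstay : A.withIdle h (S.knowledge G name) i = none := dif_neg hi.not_gt
    simp only [State.step, hstay, move]
    exact hS _ List.mem_cons_self i hi
  · exact hS c hc i hi

theorem idleAt_run_withIdle (h : l ≤ k) (t : ℕ) :
    (run G r name (A.withIdle h) t).IdleAt l r := by
  induction t with
  | zero =>
    intro c hc i _
    rw [List.mem_singleton.1 hc]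
    rfl
  | succ t ih =>
    rw [run_succ]
    exact ih.step_withIdle h

theorem restrict_run_withIdle (hl : 1 ≤ l) (h : l ≤ k) (t : ℕ) :
    (run G r name (A.withIdle h) t).restrict h = run G r name A t := by
  induction t with
  | zero => rfl
  | succ t ih =>
    have hr := root_mem_visited_run (G := G) (r := r) (name := name) (A := A) hl t
    rw [← ih] at hr
    rw [run_succ, run_succ, State.restrict_step_withIdle h
      ((idleAt_run_withIdle h t).visited_restrict h hr), ih]

theorem Terminated.withIdle (hl : 1 ≤ l) (h : l ≤ k) {t : ℕ} (ht : Terminated G r name A t) :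
    Terminated G r name (A.withIdle h) t := by
  have hpos (s : ℕ) (i : Fin l) : (run G r name A s).pos i =
      (run G r name (A.withIdle h) s).pos (Fin.castLE h i) := by
    rw [← restrict_run_withIdle hl h]; rfl
  refine ⟨fun u v huv => ?_, fun i => ?_⟩
  · obtain ⟨s, hs, i, hi⟩ := ht.1 u v huv
    rw [hpos, hpos] at hi
    exact ⟨s, hs, _, hi⟩
  · obtain hi | hi := lt_or_ge i.val l
    · exact (hpos t ⟨i, hi⟩).symm.trans (ht.2 _)
    · exact idleAt_run_withIdle h t _ List.mem_cons_self i hi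

end Idle

section Bounds

variable {k : ℕ} (hk : 1 ≤ k)

include hk

theorem exists_terminated_explorer_le {V : Type*} [Fintype V] {G : SimpleGraph V} (hG : G.IsTree)
    (r : V) (name : V ↪ ℕ) : ∃ t : ℕ, Terminated G r name (explorer k) t ∧
      (t : ℝ) ≤ 2 * (Fintype.card V : ℝ) / k + 69 * (k * (depth G r : ℝ)) := by
  obtain ⟨t, ht, hle⟩ := exists_terminated_explorer hk hG r name
  refine ⟨t, ht, ?_⟩
  have hk' : (0 : ℝ) < k := by exact_mod_cast hk
  have hle' : (k * t : ℝ) ≤ 2 * Fintype.card V + 69 * (k * k * depth G r) := by exact_mod_cast hle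
  rw [div_add' _ _ _ hk'.ne', le_div_iff₀ hk']
  linarith

theorem sqrt_le_two_mul_nat_sqrt : √(k : ℝ) ≤ 2 * Nat.sqrt k := by
  have hsqrt : (1 : ℝ) ≤ Nat.sqrt k := by exact_mod_cast Nat.sqrt_pos.2 hk
  have := Real.real_sqrt_le_nat_sqrt_succ (a := k)
  linarith

theorem two_mul_div_nat_sqrt_add_le {n D C : ℝ} (hn : 0 ≤ n) (hD : 0 ≤ D) (hC : 4 ≤ C) :
    2 * n / Nat.sqrt k + C * (Nat.sqrt k * D) ≤ C * (√(k : ℝ) * (n / k + D)) := by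
  have hk' : (0 : ℝ) < k := by exact_mod_cast hk
  have hpos : (0 : ℝ) < Nat.sqrt k := by exact_mod_cast Nat.sqrt_pos.2 hk
  have hnodes : 2 * n / Nat.sqrt k ≤ C * (√(k : ℝ) * (n / k)) :=
    calc 2 * n / Nat.sqrt k ≤ 4 * (n / √(k : ℝ)) := by
          rw [← mul_div_assoc, div_le_div_iff₀ hpos (Real.sqrt_pos.2 hk')]
          nlinarith [sqrt_le_two_mul_nat_sqrt hk]
      _ ≤ C * (n / √(k : ℝ)) := by gcongr
      _ = C * (√(k : ℝ) * (n / k)) := by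
          rw [mul_div_left_comm √(k : ℝ) n, Real.sqrt_div_self', mul_one_div]
  have hdepth : C * (Nat.sqrt k * D) ≤ C * (√(k : ℝ) * D) := by
    gcongr
    exact Real.nat_sqrt_le_real_sqrt
  linarith

end Bounds

end CTE

theorem mainTheorem1 :
    ∃ A : ∀ k : ℕ, CTE.Algorithm k,
      (∃ C : ℝ, 0 < C ∧
        ∀ k : ℕ, 1 ≤ k →
        ∀ (V : Type u) [Fintype V] (G : SimpleGraph V) (_ : G.IsTree) (r : V) (name : V ↪ ℕ),
          (CTE.runtime G r name (A k) : ENNReal) ≤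
            ENNReal.ofReal (2 * (Fintype.card V : ℝ) / k + C * (k * (CTE.depth G r : ℝ)))) ∧
      (∃ C : ℝ, 0 < C ∧
        ∀ k : ℕ, 1 ≤ k →
        ∀ (V : Type u) [Fintype V] (G : SimpleGraph V) (_ : G.IsTree) (r : V) (name : V ↪ ℕ),
          (CTE.runtime G r name ((A (Nat.sqrt k)).withIdle (Nat.sqrt_le_self k)) : ENNReal) ≤
            ENNReal.ofReal
              (C * (√(k : ℝ) * ((Fintype.card V : ℝ) / k + (CTE.depth G r : ℝ))))) := by
  refine ⟨CTE.explorer, ⟨69, by norm_num, fun k hk V _ G hG r name => ?_⟩,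
    ⟨69, by norm_num, fun k hk V _ G hG r name => ?_⟩⟩
  · obtain ⟨t, ht, hle⟩ := CTE.exists_terminated_explorer_le hk hG r name
    exact ht.runtime_le hle
  · have hsqrt : 1 ≤ Nat.sqrt k := Nat.sqrt_pos.2 hk
    obtain ⟨t, ht, hle⟩ := CTE.exists_terminated_explorer_le hsqrt hG r name
    refine (ht.withIdle hsqrt (Nat.sqrt_le_self k)).runtime_le (hle.trans ?_)
    exact CTE.two_mul_div_nat_sqrt_add_le hk (Nat.cast_nonneg _) (Nat.cast_nonneg _) (by norm_num)
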